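/- A \emph{precontraction group} is an ordered abelian group $\Gamma$ with a map $\chi:\Gamma\to\Gamma$ such that for all $a,b\in\Gamma$: $\chi(a)=0\Leftrightarrow a=0$; $a\le b\Rightarrow\chi(a)\le\chi(b)$; $\chi(-a)=-\chi(a)$; and $\chi(a)=\chi(b)$ whenever $a,b$ are archimedean equivalent and have the same sign. It is \emph{centripetal} if $|\chi(a)|<|a|$ for all $a\ne 0$. A nontrivial divisible centripetal precontraction group $(\Gamma,\chi)$ with a distinguished element $c$ is a \emph{model of $T_{pdg}$} if, with $\Delta:=\chi(\Gamma^{<0})$, (1) $c$ is the least element of $\Delta$; (2) $\chi$ restricts to a bijection $\Delta\to\Delta^{>c}$; (3) for all $a,b\in\Delta$ with $a<b$ one has $a<\chi(a)\le b$. Let $L_{pdg*}=\{+,-,0,<,\chi,c,\infty,\chi^{-1},\delta_1,\delta_2,\dots\}$. Each model $(\Gamma,\chi)$ of $T_{pdg}$ is expanded to an $L_{pdg*}$-structure with underlying set $\Gamma_\infty=\Gamma\cup\{\infty\}$, where $a<\infty$ for all $a\in\Gamma$; $x+\infty=\infty+x=\infty$ for all $x \in \Gamma_\infty$; $-\infty=\chi(\infty)=\delta_n(\infty)=\infty$;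 $\delta_n$ is division by $n$ on $\Gamma$; and $\chi^{-1}:\Gamma_\infty\to\Gamma_\infty$ is the inverse of $\chi:\Delta\to\Delta^{>c}$ on $\Delta^{>c}$, satisfies $\chi^{-1}(0)=0$ and $\chi^{-1}(-a)=-\chi^{-1}(a)$ for $a\in\Delta^{>c}$, and takes the value $\infty$ at all other elements (in particular at $\pm c$, at $\infty$ and outside $\chi(\Gamma)$). The theory $T_{pdg*}$ is the $L_{pdg*}$-theory of these expansions, which are its models. A structure with a total order is \emph{weakly o-minimal} if every subset of it that is definable with parameters is a finite union of convex subsets; a theory is weakly o-minimal if all of its models are. Let $(\Gamma,\chi)$ be a model of $T_{pdg}$, expanded to a model $\Gamma_\infty$ of $T_{pdg*}$. Then every subset $A\subseteq\chi(\Gamma^{<0})$ which is definable (with parameters) in the $L_{pdg*}$-structure $\Gamma_\infty$ is a finite union of singletons and of intervals of the ordered set $\chi(\Gamma^{<0})$ (with endpoints in $\chi(\Gamma^{<0})\cup\{-\infty,+\infty\}$). Moreover $\Gamma_\infty$ is not weakly o-minimal. In particular, the theory $T_{pdg*}$ is not weakly o-minimal. -/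

import Mathlib

open FirstOrder

universe u

/-! ### Precontraction groups and models of `T_pdg` -/

section Groups

variable {Γ : Type u} [AddCommGroup Γ] [LinearOrder Γ] [IsOrderedAddMonoid Γ]

/-- `χ` is a precontraction map on the ordered abelian group `Γ`. Two elements are archimedean
equivalent when they have the same image in `ArchimedeanClass Γ`. -/
structure IsPrecontraction (χ : Γ → Γ) : Prop where
  map_eq_zero_iff : ∀ a, χ a = 0 ↔ a = 0
  monotone : ∀ a b, a ≤ b → χ a ≤ χ b
  map_neg : ∀ a, χ (-a) = -χ a
  map_eq_of_archimedean_equiv : ∀ a b, ArchimedeanClass.mk a = ArchimedeanClass.mk b →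
    SignType.sign a = SignType.sign b → χ a = χ b

/-- The set `χ(Γ^{<0})`. -/
def chiNeg (χ : Γ → Γ) : Set Γ := χ '' {a | a < 0}

/-- `(Γ, χ)`, with `c` interpreting the constant symbol, is a model of `T_pdg`: a nontrivial
divisible centripetal precontraction group in which `χ(Γ^{<0})` has least element `c`, and `χ` is
the successor map of `χ(Γ^{<0})` and maps it bijectively onto its elements above `c`. -/
structure IsModelTpdg (χ : Γ → Γ) (c : Γ) : Prop where
  nontrivial : Nontrivial Γ
  precontraction : IsPrecontraction χ
  centripetal : ∀ a, a ≠ 0 → |χ a| < |a|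
  isLeast : IsLeast (chiNeg χ) c
  bijOn : Set.BijOn χ (chiNeg χ) {x ∈ chiNeg χ | c < x}
  succ : ∀ a ∈ chiNeg χ, ∀ b ∈ chiNeg χ, a < b → a < χ a ∧ χ a ≤ b
  divisible : ∀ n : ℕ, 0 < n → ∀ a : Γ, ∃ b : Γ, n • b = a

end Groups

/-! ### The language `L_pdg*` -/

/-- The function symbols `0, c, ∞` (constants), `-, χ, χ⁻¹, δ_n` for `n > 0` (unary) and
`+` (binary). -/
inductive PdgStarFunc : ℕ → Type
  | zero : PdgStarFunc 0
  | c : PdgStarFunc 0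
  | infty : PdgStarFunc 0
  | neg : PdgStarFunc 1
  | chi : PdgStarFunc 1
  | chiInv : PdgStarFunc 1
  | delta (n : ℕ+) : PdgStarFunc 1
  | add : PdgStarFunc 2

/-- The only relation symbol is the binary symbol `<`. -/
inductive PdgStarRel : ℕ → Type
  | lt : PdgStarRel 2

/-- The language `L_pdg* = {+, -, 0, <, χ, c, ∞, χ⁻¹, δ_1, δ_2, …}`. -/
def LpdgStar : Language := ⟨PdgStarFunc, PdgStarRel⟩

/-- The order symbol of `L_pdg*`. -/
def LpdgStar.ltSymb : LpdgStar.Relations 2 := PdgStarRel.lt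

/-! ### The expansion of a model of `T_pdg` to an `L_pdg*`-structure -/

section Expansion

variable {Γ : Type u} [AddCommGroup Γ] [LinearOrder Γ] [IsOrderedAddMonoid Γ]

open Classical in
/-- The function `χ⁻¹ : Γ_∞ → Γ_∞`: inverse to `χ` on `χ(χ(Γ^{<0}))`, extended by `χ⁻¹(0) = 0`
and oddly to `-χ(χ(Γ^{<0}))`, with value `∞` everywhere else (in particular at `c`, `∞`, and
outside of `χ(Γ)`). -/
noncomputable def chiInvFun (χ : Γ → Γ) : WithTop Γ → WithTop Γ
  | ⊤ => ⊤
  | (a : Γ) =>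
    if a = 0 then ((0 : Γ) : WithTop Γ)
    else if a ∈ χ '' chiNeg χ then ((Function.invFunOn χ (chiNeg χ) a : Γ) : WithTop Γ)
    else if -a ∈ χ '' chiNeg χ then ((-Function.invFunOn χ (chiNeg χ) (-a) : Γ) : WithTop Γ)
    else ⊤

/-- Division by `n` on `Γ` (in a model of `T_pdg` the map `b ↦ n • b` is bijective for `n > 0`). -/
noncomputable def divFun (n : ℕ) : Γ → Γ := Function.invFun (fun b : Γ => n • b)

/-- The set `Γ_∞ = Γ ∪ {∞}`, ordered by `a < ∞` for all `a` in `Γ`, as the universe of the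
`L_pdg*`-structure attached to `(Γ, χ, c)`. -/
def GammaInf (_χ : Γ → Γ) (_c : Γ) : Type u := WithTop Γ

noncomputable instance (χ : Γ → Γ) (c : Γ) : LinearOrder (GammaInf χ c) :=
  inferInstanceAs (LinearOrder (WithTop Γ))

/-- The inclusion of `Γ` in `Γ_∞`. -/
def GammaInf.of (χ : Γ → Γ) (c : Γ) (a : Γ) : GammaInf χ c := (a : WithTop Γ)

/-- The interpretation of the symbols of `L_pdg*` in `Γ_∞`; here `x + ∞ = ∞ + x = ∞` and
`-∞ = χ(∞) = δ_n(∞) = ∞`. -/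
noncomputable instance (χ : Γ → Γ) (c : Γ) : LpdgStar.Structure (GammaInf χ c) where
  funMap {_} f :=
    match f with
    | PdgStarFunc.zero => fun _ => ((0 : Γ) : WithTop Γ)
    | PdgStarFunc.c => fun _ => (c : WithTop Γ)
    | PdgStarFunc.infty => fun _ => (⊤ : WithTop Γ)
    | PdgStarFunc.neg => fun x => WithTop.map (fun a : Γ => -a) (x 0)
    | PdgStarFunc.chi => fun x => WithTop.map χ (x 0)
    | PdgStarFunc.chiInv => fun x => chiInvFun χ (x 0)
    | PdgStarFunc.delta n => fun x => WithTop.map (divFun (n : ℕ)) (x 0)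
    | PdgStarFunc.add => fun x => HAdd.hAdd (α := WithTop Γ) (β := WithTop Γ) (x 0) (x 1)
  RelMap {_} r :=
    match r with
    | PdgStarRel.lt => fun x => x 0 < x 1

/-- The set `χ(Γ^{<0})` as a subset of `Γ_∞`. -/
def chiNegInf (χ : Γ → Γ) (c : Γ) : Set (GammaInf χ c) := GammaInf.of χ c '' chiNeg χ

end Expansion

/-- The theory `T_pdg*`: the set of all `L_pdg*`-sentences which hold in the expansions `Γ_∞` of
all models of `T_pdg`. -/
def TpdgStar : LpdgStar.Theory :=
  {φ | ∀ (Γ : Type u) [AddCommGroup Γ] [LinearOrder Γ] [IsOrderedAddMonoid Γ]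
    (χ : Γ → Γ) (c : Γ), IsModelTpdg χ c → GammaInf χ c ⊨ φ}

/-! ### Intervals and weak o-minimality -/

/-- Intervals of a linearly ordered set `S`, with endpoints in `S ∪ {-∞, +∞}`. -/
inductive IsInterval {S : Type u} [LinearOrder S] : Set S → Prop
  | Ioo (a b : S) : IsInterval (Set.Ioo a b)
  | Ico (a b : S) : IsInterval (Set.Ico a b)
  | Ioc (a b : S) : IsInterval (Set.Ioc a b)
  | Icc (a b : S) : IsInterval (Set.Icc a b)
  | Iio (a : S) : IsInterval (Set.Iio a)
  | Iic (a : S) : IsInterval (Set.Iic a)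
  | Ioi (a : S) : IsInterval (Set.Ioi a)
  | Ici (a : S) : IsInterval (Set.Ici a)
  | univ : IsInterval Set.univ

/-- A structure `M`, strictly ordered by the relation symbol `r`, is weakly o-minimal if every
subset of `M` definable with parameters is a finite union of convex subsets of `M`. -/
def IsWeaklyOMinimalStructure (L : Language) (r : L.Relations 2) (M : Type u) [L.Structure M] :
    Prop :=
  ∀ A : Set M, (Set.univ : Set M).Definable₁ L A →
    ∃ F : Set (Set M), F.Finite ∧
      (∀ C ∈ F, ∀ x ∈ C, ∀ z ∈ C, ∀ y : M, Language.Structure.RelMap r ![x, y] →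
        Language.Structure.RelMap r ![y, z] → y ∈ C) ∧
      A = ⋃₀ F

/-- A theory `T`, in whose models the symbol `r` is interpreted by a strict total order, is weakly
o-minimal if all of its models are. -/
def IsWeaklyOMinimalTheory {L : Language} (T : L.Theory) (r : L.Relations 2) : Prop :=
  ∀ (M : Type u) [L.Structure M] [Nonempty M], M ⊨ T → IsWeaklyOMinimalStructure L r M

/-! Write Δ for χ(Γ^{<0}). The interval statement holds because Δ inherits no more from `Γ_∞` than a
discrete order with least element `c` and successor χ: elements of Δ outside a countable
substructure `K` that realize the same cut over `K` ∩ Δ cannot be told apart by formulas over `K`.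

This is proved by back-and-forth in an ultrapower of Γ over ℕ, between countable ℚ-subspaces
containing `c` and closed under χ and χ⁻¹ (`IsBackAndForth`). To send `d` in Δ to `d'` with the
corresponding cut, all successors and predecessors must be sent along; they can be adjoined because
distinct elements of Δ have distinct χ-values, so every new sum is dominated by one of its terms
(`exists_fill`, `exists_extension_of_cut`). For an arbitrary `b`, the domain is first closed under
the values χ(`b` - `a`). Then `b` is described over the domain by its cut and these values, and
countable saturation of the ultrapower yields an image (`exists_extension_of_distances`). Matched
sequences therefore satisfy the same formulas at almost all coordinates (`Matched.realize_iff`).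

If a definable subset of Δ were not a finite union of intervals, there would be members `x n` and
non-members `y n` in the same position relative to the first `n` elements of `K` ∩ Δ, with `K`
generated by the parameters. Their germs realize one cut over `K`, so they are matched over the
identity of `K`, a contradiction.

Weak o-minimality fails because Δ itself is definable and has infinitely many convex components:
half of `d` in Δ lies strictly between `d` and its successor, and is not in Δ. For the theory, a
model must also be exhibited; lexicographically ordered rational sequences provide one. -/

set_option linter.unusedSectionVars false

/-! ### χ as a valuation-like map, and the discrete order Δ -/

section Algebra

variable {Γ : Type u} [AddCommGroup Γ] [LinearOrder Γ] [IsOrderedAddMonoid Γ]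
  {χ : Γ → Γ} {c : Γ}

namespace IsPrecontraction

theorem map_zero (h : IsPrecontraction χ) : χ 0 = 0 := (h.map_eq_zero_iff 0).2 rfl

theorem map_nonneg (h : IsPrecontraction χ) {a : Γ} (ha : 0 ≤ a) : 0 ≤ χ a := by
  simpa [h.map_zero] using h.monotone 0 a ha

theorem map_nonpos (h : IsPrecontraction χ) {a : Γ} (ha : a ≤ 0) : χ a ≤ 0 := by
  simpa [h.map_zero] using h.monotone a 0 ha

theorem map_pos_iff (h : IsPrecontraction χ) {a : Γ} : 0 < χ a ↔ 0 < a := by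
  refine ⟨fun ha => ?_, fun ha => ?_⟩
  · by_contra hn
    exact absurd (h.map_nonpos (not_lt.1 hn)) (not_le.2 ha)
  · exact lt_of_le_of_ne (h.map_nonneg ha.le) (fun e => ha.ne' ((h.map_eq_zero_iff a).1 e.symm))

theorem map_neg_iff (h : IsPrecontraction χ) {a : Γ} : χ a < 0 ↔ a < 0 := by
  have := h.map_pos_iff (a := -a)
  rw [h.map_neg] at this
  simpa using this

theorem abs_map (h : IsPrecontraction χ) (a : Γ) : |χ a| = χ |a| := by
  rcases le_total 0 a with ha | ha
  · rw [abs_of_nonneg ha, abs_of_nonneg (h.map_nonneg ha)]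
  · rw [abs_of_nonpos ha, abs_of_nonpos (h.map_nonpos ha), h.map_neg]

theorem map_eq_of_pos (h : IsPrecontraction χ) {a b : Γ} (ha : 0 < a) (hb : 0 < b) {m n : ℕ}
    (h1 : a ≤ m • b) (h2 : b ≤ n • a) : χ a = χ b := by
  refine h.map_eq_of_archimedean_equiv a b ?_ (by rw [sign_pos ha, sign_pos hb])
  rw [ArchimedeanClass.mk_eq_mk, abs_of_pos ha, abs_of_pos hb]
  exact ⟨⟨n, h2⟩, ⟨m, h1⟩⟩

theorem map_two_nsmul (h : IsPrecontraction χ) (a : Γ) : χ (a + a) = χ a := by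
  have key : ∀ a : Γ, 0 < a → χ (a + a) = χ a := fun a ha =>
    h.map_eq_of_pos (add_pos ha ha) ha (m := 2) (n := 1) (by rw [two_nsmul])
      (by rw [one_nsmul]; exact le_add_of_nonneg_left ha.le)
  rcases lt_trichotomy a 0 with ha | rfl | ha
  · have := key (-a) (neg_pos.2 ha)
    rw [← neg_add, h.map_neg, h.map_neg] at this
    exact neg_inj.1 this
  · simp
  · exact key a ha

/-- The sum lies between the larger summand and its double, and doubling does not change χ. -/
theorem map_add_of_nonneg (h : IsPrecontraction χ) {a b : Γ} (ha : 0 ≤ a) (hb : 0 ≤ b) :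
    χ (a + b) = max (χ a) (χ b) := by
  apply le_antisymm
  · rcases le_total a b with hab | hab
    · refine le_max_of_le_right ?_
      rw [← h.map_two_nsmul b]
      exact h.monotone _ _ (by gcongr)
    · refine le_max_of_le_left ?_
      rw [← h.map_two_nsmul a]
      exact h.monotone _ _ (by gcongr)
  · exact max_le (h.monotone _ _ (le_add_of_nonneg_right hb))
      (h.monotone _ _ (le_add_of_nonneg_left ha))

/-- A strict inequality of χ-values makes `a` negligible against `b`: `2|a| < b`, as otherwise χ(b)
≤ χ(2|a|) = χ(|a|). Hence `b ≤ 2(a + b)` and `a + b ≤ 2b`, and doubling does not change χ. -/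
theorem add_pos_of_dominated (h : IsPrecontraction χ) {a b : Γ} (hb : 0 < b)
    (hab : |χ a| < |χ b|) : 0 < a + b ∧ χ (a + b) = χ b := by
  rw [h.abs_map, h.abs_map, abs_of_pos hb] at hab
  have h2 : |a| + |a| < b := by
    by_contra hn
    have := h.monotone _ _ (not_lt.1 hn)
    rw [h.map_two_nsmul] at this
    exact absurd this (not_le.2 hab)
  have h0 : |a| < b := lt_of_le_of_lt (le_add_of_nonneg_left (abs_nonneg a)) h2
  have h3 : -|a| ≤ a := neg_abs_le a
  refine ⟨?_, ?_⟩
  · have : -a ≤ |a| := neg_le_abs a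
    have := lt_of_le_of_lt this h0
    simpa [add_comm] using (sub_pos.2 this)
  · apply le_antisymm
    · rw [← h.map_two_nsmul b]
      refine h.monotone _ _ ?_
      have := (le_abs_self a).trans h0.le
      gcongr
    · rw [← h.map_two_nsmul (a + b)]
      refine h.monotone _ _ ?_
      have h4 : |a| + |a| ≤ b := h2.le
      have h5 : 0 ≤ a + |a| := by simpa using add_le_add_left h3 |a|
      calc b ≤ b + ((a + |a|) + (a + |a|) + (b - (|a| + |a|))) :=
            le_add_of_nonneg_right (add_nonneg (add_nonneg h5 h5) (sub_nonneg.2 h4))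
        _ = a + b + (a + b) := by abel

theorem add_neg_of_dominated (h : IsPrecontraction χ) {a b : Γ} (hb : b < 0)
    (hab : |χ a| < |χ b|) : a + b < 0 ∧ χ (a + b) = χ b := by
  have := h.add_pos_of_dominated (a := -a) (b := -b) (neg_pos.2 hb)
    (by simpa [h.map_neg] using hab)
  rw [← neg_add, h.map_neg, h.map_neg, neg_inj, neg_pos] at this
  exact this

theorem map_smul_of_pos [Module ℚ Γ] [PosSMulStrictMono ℚ Γ] (h : IsPrecontraction χ) {r : ℚ}
    (hr : 0 < r) (a : Γ) : χ (r • a) = χ a := by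
  -- Used for `r` and for its inverse, this gives both halves of the archimedean equivalence of `a`
  -- and `r • a`.
  have hmono : ∀ (r : ℚ) (a : Γ), 0 < r → 0 < a → ∃ n : ℕ, a ≤ n • (r • a) := by
    intro r a hr ha
    obtain ⟨n, hn⟩ := exists_nat_ge r⁻¹
    refine ⟨n, ?_⟩
    rw [← Nat.cast_smul_eq_nsmul ℚ, smul_smul]
    have h1 : (1 : ℚ) ≤ n * r := by
      calc (1 : ℚ) = r⁻¹ * r := by field_simp
        _ ≤ n * r := by gcongr
    have h2 : 0 ≤ (n * r - 1) • a := by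
      rcases h1.eq_or_lt with e | e
      · rw [← e]; simp
      · exact (smul_pos (sub_pos.2 e) ha).le
    rw [sub_smul, one_smul] at h2
    exact sub_nonneg.1 h2
  have key : ∀ a : Γ, 0 < a → χ (r • a) = χ a := by
    intro a ha
    have hra : 0 < r • a := smul_pos hr ha
    obtain ⟨n, hn⟩ := hmono r a hr ha
    obtain ⟨m, hm⟩ := hmono r⁻¹ (r • a) (inv_pos.2 hr) hra
    rw [inv_smul_smul₀ hr.ne'] at hm
    exact h.map_eq_of_pos hra ha hm hn
  rcases lt_trichotomy a 0 with ha | rfl | ha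
  · have := key (-a) (neg_pos.2 ha)
    rw [smul_neg, h.map_neg, h.map_neg] at this
    exact neg_inj.1 this
  · simp
  · exact key a ha

end IsPrecontraction

namespace IsModelTpdg

theorem neg_of_mem (h : IsModelTpdg χ c) {d : Γ} (hd : d ∈ chiNeg χ) : d < 0 := by
  obtain ⟨a, ha, rfl⟩ := hd
  exact h.precontraction.map_neg_iff.2 ha

theorem chi_mem (h : IsModelTpdg χ c) {d : Γ} (hd : d ∈ chiNeg χ) : χ d ∈ chiNeg χ :=
  ⟨d, h.neg_of_mem hd, rfl⟩

theorem c_mem (h : IsModelTpdg χ c) : c ∈ chiNeg χ := h.isLeast.1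

theorem c_le (h : IsModelTpdg χ c) {d : Γ} (hd : d ∈ chiNeg χ) : c ≤ d := h.isLeast.2 hd

theorem lt_chi (h : IsModelTpdg χ c) {d : Γ} (hd : d < 0) : d < χ d := by
  have := h.centripetal d hd.ne
  rw [abs_of_neg hd, abs_of_neg (h.precontraction.map_neg_iff.2 hd)] at this
  exact neg_lt_neg_iff.1 this

theorem chi_inj (h : IsModelTpdg χ c) {d e : Γ} (hd : d ∈ chiNeg χ) (he : e ∈ chiNeg χ)
    (hde : χ d = χ e) : d = e := h.bijOn.injOn hd he hde

theorem chi_lt_chi (h : IsModelTpdg χ c) {d e : Γ} (hd : d ∈ chiNeg χ) (he : e ∈ chiNeg χ) :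
    χ d < χ e ↔ d < e := by
  refine ⟨fun hlt => ?_, fun hlt => ?_⟩
  · by_contra hn
    exact absurd (h.precontraction.monotone _ _ (not_lt.1 hn)) (not_le.2 hlt)
  · exact lt_of_le_of_ne (h.precontraction.monotone _ _ hlt.le)
      (fun e' => hlt.ne (h.chi_inj hd he e'))

theorem chi_le (h : IsModelTpdg χ c) {d e : Γ} (hd : d ∈ chiNeg χ) (he : e ∈ chiNeg χ)
    (hde : d < e) : χ d ≤ e := (h.succ d hd e he hde).2

theorem exists_pred (h : IsModelTpdg χ c) {d : Γ} (hd : d ∈ chiNeg χ) (hc : c < d) :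
    ∃ e ∈ chiNeg χ, χ e = d := by
  obtain ⟨e, he, hed⟩ := h.bijOn.surjOn (⟨hd, hc⟩ : d ∈ {x ∈ chiNeg χ | c < x})
  exact ⟨e, he, hed⟩

theorem c_lt_chi (h : IsModelTpdg χ c) {d : Γ} (hd : d ∈ chiNeg χ) : c < χ d :=
  (h.bijOn.mapsTo hd).2

theorem iterate_mem (h : IsModelTpdg χ c) {d : Γ} (hd : d ∈ chiNeg χ) (n : ℕ) :
    χ^[n] d ∈ chiNeg χ := by
  induction n with
  | zero => exact hd
  | succ n ih => rw [Function.iterate_succ_apply']; exact h.chi_mem ih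

theorem iterate_lt_iterate (h : IsModelTpdg χ c) {d e : Γ} (hd : d ∈ chiNeg χ)
    (he : e ∈ chiNeg χ) (n : ℕ) : χ^[n] d < χ^[n] e ↔ d < e := by
  induction n with
  | zero => rfl
  | succ n ih =>
    rw [Function.iterate_succ_apply', Function.iterate_succ_apply',
      h.chi_lt_chi (h.iterate_mem hd n) (h.iterate_mem he n), ih]

theorem iterate_inj (h : IsModelTpdg χ c) {d e : Γ} (hd : d ∈ chiNeg χ)
    (he : e ∈ chiNeg χ) {n : ℕ} (hde : χ^[n] d = χ^[n] e) : d = e := by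
  by_contra hne
  rcases lt_or_gt_of_ne hne with hlt | hlt
  · exact ((h.iterate_lt_iterate hd he n).2 hlt).ne hde
  · exact ((h.iterate_lt_iterate he hd n).2 hlt).ne' hde

theorem iterate_strictMono (h : IsModelTpdg χ c) {d : Γ} (hd : d ∈ chiNeg χ) :
    StrictMono (fun n => χ^[n] d) := by
  refine strictMono_nat_of_lt_succ fun n => ?_
  simp only [Function.iterate_succ_apply']
  exact h.lt_chi (h.neg_of_mem (h.iterate_mem hd n))

/-- A gap of prescribed `χ`-widths can be split. -/
theorem exists_between [Module ℚ Γ] [PosSMulStrictMono ℚ Γ] (h : IsModelTpdg χ c) {u w z₁ z₂ : Γ}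
    (huw : u < w) (hz₁ : 0 < z₁) (hz₂ : 0 < z₂) (hmax : χ (w - u) = max (χ z₁) (χ z₂)) :
    ∃ b, u < b ∧ b < w ∧ χ (b - u) = χ z₁ ∧ χ (w - b) = χ z₂ := by
  have hp := h.precontraction
  have hwu : 0 < w - u := sub_pos.2 huw
  have hχ : ∀ {z : Γ}, 0 < z → |χ z| = χ z := fun hz => abs_of_pos (hp.map_pos_iff.2 hz)
  -- The point is reached from the end with the smaller prescribed width: that step is negligible
  -- against `w - u`, so the remaining gap keeps the larger width. For equal widths the midpoint
  -- works.
  rcases lt_trichotomy (χ z₁) (χ z₂) with hlt | heq | hlt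
  · rw [max_eq_right hlt.le] at hmax
    have := hp.add_pos_of_dominated (a := -z₁) (b := w - u) hwu
      (by rw [hp.map_neg, abs_neg, hχ hz₁, hχ hwu, hmax]; exact hlt)
    have e : w - (u + z₁) = -z₁ + (w - u) := by abel
    refine ⟨u + z₁, by simpa using hz₁, sub_pos.1 (e ▸ this.1), by simp, ?_⟩
    rw [e, this.2, hmax]
  · rw [heq, max_self] at hmax
    obtain ⟨m, hm⟩ : ∃ m, m = (1 / 2 : ℚ) • (w - u) := ⟨_, rfl⟩
    have hmm : m + m = w - u := by
      rw [hm, ← add_smul]; norm_num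
    have hpos : 0 < m := hm ▸ smul_pos (by norm_num) hwu
    have hχm : χ m = χ z₂ := by rw [hm, hp.map_smul_of_pos (by norm_num), hmax]
    have e1 : w - (u + m) = m := by rw [← sub_sub, ← hmm, add_sub_cancel_right]
    refine ⟨u + m, by simpa using hpos, sub_pos.1 (e1.symm ▸ hpos), ?_, ?_⟩
    · rw [add_sub_cancel_left, hχm, heq]
    · rw [e1, hχm]
  · rw [max_eq_left hlt.le] at hmax
    have := hp.add_pos_of_dominated (a := -z₂) (b := w - u) hwu
      (by rw [hp.map_neg, abs_neg, hχ hz₂, hχ hwu, hmax]; exact hlt)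
    have e : w - z₂ - u = -z₂ + (w - u) := by abel
    refine ⟨w - z₂, sub_pos.1 (e ▸ this.1), by simpa using hz₂, ?_, by simp⟩
    rw [e, this.2, hmax]

end IsModelTpdg

end Algebra

/-! ### Partial isomorphisms over a partial automorphism of Δ -/

section BackAndForth

variable {Γ : Type u} [AddCommGroup Γ] [LinearOrder Γ] [IsOrderedAddMonoid Γ]
  {χ : Γ → Γ} {c : Γ}

/-- A partial automorphism of the ordered set `χ(Γ^{<0})`, given by its graph, whose domain and
image are closed under successors and predecessors. -/
structure IsDeltaIso (χ : Γ → Γ) (τ : Set (Γ × Γ)) : Prop where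
  fst_mem : ∀ e ∈ τ, e.1 ∈ chiNeg χ
  snd_mem : ∀ e ∈ τ, e.2 ∈ chiNeg χ
  lt_iff : ∀ e ∈ τ, ∀ f ∈ τ, e.1 < f.1 ↔ e.2 < f.2
  chi_mem : ∀ e ∈ τ, (χ e.1, χ e.2) ∈ τ
  pred_mem : ∀ d ∈ chiNeg χ, ∀ d' ∈ chiNeg χ, (χ d, χ d') ∈ τ → (d, d') ∈ τ

theorem IsDeltaIso.eq_iff {τ : Set (Γ × Γ)} (ht : IsDeltaIso χ τ) {e f : Γ × Γ} (he : e ∈ τ)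
    (hf : f ∈ τ) : e.1 = f.1 ↔ e.2 = f.2 := by
  have h1 := ht.lt_iff e he f hf
  have h2 := ht.lt_iff f hf e he
  constructor
  · intro h
    exact le_antisymm (not_lt.1 fun h' => (h2.2 h').ne' h) (not_lt.1 fun h' => (h1.2 h').ne h)
  · intro h
    exact le_antisymm (not_lt.1 fun h' => (h2.1 h').ne' h) (not_lt.1 fun h' => (h1.1 h').ne h)

/-- The odd extension of `τ`, together with `(0, 0)`. -/
def oddExt (τ : Set (Γ × Γ)) : Set (Γ × Γ) := {p | p = 0 ∨ p ∈ τ ∨ -p ∈ τ}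

theorem neg_mem_oddExt {τ : Set (Γ × Γ)} {p : Γ × Γ} (hp : p ∈ oddExt τ) : -p ∈ oddExt τ := by
  rcases hp with rfl | hp | hp
  · left; simp
  · right; right; simpa using hp
  · right; left; exact hp

theorem oddExt_mono {τ τ' : Set (Γ × Γ)} (h : τ ⊆ τ') : oddExt τ ⊆ oddExt τ' := by
  rintro p (hp | hp | hp)
  exacts [Or.inl hp, Or.inr (Or.inl (h hp)), Or.inr (Or.inr (h hp))]

theorem mem_of_mem_oddExt (h : IsModelTpdg χ c) {τ : Set (Γ × Γ)} (ht : IsDeltaIso χ τ)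
    {p : Γ × Γ} (hp : p ∈ oddExt τ) (hneg : p.1 < 0) : p ∈ τ := by
  rcases hp with rfl | hp | hp
  · exact absurd hneg (lt_irrefl _)
  · exact hp
  · have := h.neg_of_mem (ht.fst_mem _ hp)
    simp only [Prod.fst_neg, neg_lt_zero] at this
    exact absurd hneg this.not_gt

variable [Module ℚ Γ]

/-- `σ` is the graph of a partial isomorphism of ordered vector spaces, whose values of `χ` are
matched by `τ`. -/
structure IsPartialIso (χ : Γ → Γ) (τ : Set (Γ × Γ)) (σ : Submodule ℚ (Γ × Γ)) : Prop where
  countable : (σ : Set (Γ × Γ)).Countable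
  pos_iff : ∀ p ∈ σ, 0 < p.1 ↔ 0 < p.2
  chi_mem : ∀ p ∈ σ, (χ p.1, χ p.2) ∈ oddExt τ

namespace IsPartialIso

variable {τ : Set (Γ × Γ)} {σ : Submodule ℚ (Γ × Γ)}

theorem neg_iff (hs : IsPartialIso χ τ σ) {p : Γ × Γ} (hp : p ∈ σ) : p.1 < 0 ↔ p.2 < 0 := by
  simpa using hs.pos_iff (-p) (σ.neg_mem hp)

theorem eq_zero_iff (hs : IsPartialIso χ τ σ) {p : Γ × Γ} (hp : p ∈ σ) : p.1 = 0 ↔ p.2 = 0 := by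
  have h1 := hs.pos_iff p hp
  have h2 := hs.neg_iff hp
  constructor
  · intro h
    exact le_antisymm (not_lt.1 fun h' => (h1.2 h').ne' h) (not_lt.1 fun h' => (h2.2 h').ne h)
  · intro h
    exact le_antisymm (not_lt.1 fun h' => (h1.1 h').ne' h) (not_lt.1 fun h' => (h2.1 h').ne h)

/-- Adjoining one pair to a partial isomorphism. -/
theorem adjoin [PosSMulStrictMono ℚ Γ] (h : IsModelTpdg χ c) (hs : IsPartialIso χ τ σ) {q : Γ × Γ}
    (hq : ∀ p ∈ σ, (0 < q.1 + p.1 ↔ 0 < q.2 + p.2) ∧ (q.1 + p.1 < 0 ↔ q.2 + p.2 < 0) ∧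
      (χ (q.1 + p.1), χ (q.2 + p.2)) ∈ oddExt τ) :
    IsPartialIso χ τ (σ ⊔ Submodule.span ℚ {q}) := by
  have hrep : ∀ x ∈ σ ⊔ Submodule.span ℚ {q}, ∃ p ∈ σ, ∃ r : ℚ, p + r • q = x := by
    intro x hx
    obtain ⟨p, hp, y, hy, rfl⟩ := Submodule.mem_sup.1 hx
    obtain ⟨r, rfl⟩ := Submodule.mem_span_singleton.1 hy
    exact ⟨p, hp, r, rfl⟩
  have key : ∀ x ∈ σ ⊔ Submodule.span ℚ {q}, (0 < x.1 ↔ 0 < x.2) ∧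
      (χ x.1, χ x.2) ∈ oddExt τ := by
    intro x hx
    obtain ⟨p, hp, r, rfl⟩ := hrep x hx
    have hpos : ∀ {r : ℚ}, 0 < r → ∀ a : Γ, 0 < r • a ↔ 0 < a := fun hr a => by
      refine ⟨fun ha => ?_, fun ha => smul_pos hr ha⟩
      have := smul_pos (inv_pos.2 hr) ha
      rwa [inv_smul_smul₀ hr.ne'] at this
    -- Dividing by `r` reduces `p + r • q` to ± an element `q + p'` with `p'` in σ; χ ignores
    -- positive scalars and is odd.
    rcases lt_trichotomy r 0 with hr | rfl | hr
    · obtain ⟨-, h2, h3⟩ := hq (r⁻¹ • p) (σ.smul_mem _ hp)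
      have e : ∀ a b : Γ, a + r • b = (-r) • (-(b + r⁻¹ • a)) := fun a b => by
        rw [smul_neg, neg_smul, neg_neg, smul_add, smul_inv_smul₀ hr.ne, add_comm]
      have hr' : 0 < -r := neg_pos.2 hr
      simp only [Prod.fst_add, Prod.snd_add, Prod.smul_fst, Prod.smul_snd] at h2 h3 ⊢
      rw [e, e, hpos hr', hpos hr', neg_pos, neg_pos, h.precontraction.map_smul_of_pos hr',
        h.precontraction.map_smul_of_pos hr', h.precontraction.map_neg, h.precontraction.map_neg]
      exact ⟨h2, neg_mem_oddExt h3⟩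
    · simpa using ⟨hs.pos_iff p hp, hs.chi_mem p hp⟩
    · obtain ⟨h1, -, h3⟩ := hq (r⁻¹ • p) (σ.smul_mem _ hp)
      have e : ∀ a b : Γ, a + r • b = r • (b + r⁻¹ • a) := fun a b => by
        rw [smul_add, smul_inv_smul₀ hr.ne', add_comm]
      simp only [Prod.fst_add, Prod.snd_add, Prod.smul_fst, Prod.smul_snd] at h1 h3 ⊢
      rw [e, e, hpos hr, hpos hr, h.precontraction.map_smul_of_pos hr,
        h.precontraction.map_smul_of_pos hr]
      exact ⟨h1, h3⟩
  refine ⟨?_, fun x hx => (key x hx).1, fun x hx => (key x hx).2⟩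
  have hc : (Set.image2 (fun p (r : ℚ) => p + r • q) (σ : Set (Γ × Γ)) Set.univ).Countable :=
    hs.countable.image2 Set.countable_univ _
  refine hc.mono fun x hx => ?_
  obtain ⟨p, hp, r, rfl⟩ := hrep x hx
  exact ⟨p, hp, r, trivial, rfl⟩

end IsPartialIso

/-- Extending a submodule countably many times along an invariant. -/
theorem exists_iterated_extension {ι : Type*} {E : Type*} [AddCommGroup E] [Module ℚ E]
    (P : Submodule ℚ E → Prop)
    (hsup : ∀ s : ℕ → Submodule ℚ E, Monotone s → (∀ n, P (s n)) → P (⨆ n, s n))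
    (Q : ι → Submodule ℚ E → Prop) (hQ : ∀ i s t, s ≤ t → Q i s → Q i t)
    (D : Set ι) (hD : D.Countable) (hext : ∀ s, P s → ∀ i ∈ D, ∃ t, s ≤ t ∧ P t ∧ Q i t)
    (s : Submodule ℚ E) (hs : P s) : ∃ t, s ≤ t ∧ P t ∧ ∀ i ∈ D, Q i t := by
  rcases D.eq_empty_or_nonempty with rfl | hne
  · exact ⟨s, le_rfl, hs, by simp⟩
  obtain ⟨f, hf⟩ := hD.exists_eq_range hne
  have hfD : ∀ n, f n ∈ D := fun n => hf ▸ Set.mem_range_self n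
  choose! g hg1 hg2 hg3 using hext
  let S : ℕ → Submodule ℚ E := fun n => Nat.rec s (fun n t => g t (f n)) n
  have hS : ∀ n, P (S n) := fun n => by
    induction n with
    | zero => exact hs
    | succ n ih => exact hg2 _ ih _ (hfD n)
  have hmono : Monotone S := monotone_nat_of_le_succ fun n => hg1 _ (hS n) _ (hfD n)
  refine ⟨⨆ n, S n, le_iSup S 0, hsup S hmono hS, fun i hi => ?_⟩
  rw [hf] at hi
  obtain ⟨n, rfl⟩ := hi
  exact hQ _ _ _ (le_iSup S (n + 1)) (hg3 _ (hS n) _ (hfD n))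

theorem mem_iSup_nat {E : Type*} [AddCommGroup E] [Module ℚ E] {s : ℕ → Submodule ℚ E}
    (hs : Monotone s) {x : E} : x ∈ ⨆ n, s n ↔ ∃ n, x ∈ s n :=
  Submodule.mem_iSup_of_directed s hs.directed_le

theorem countable_iSup_nat {E : Type*} [AddCommGroup E] [Module ℚ E] {s : ℕ → Submodule ℚ E}
    (hs : Monotone s) (hc : ∀ n, (s n : Set E).Countable) :
    ((⨆ n, s n : Submodule ℚ E) : Set E).Countable := by
  refine (Set.countable_iUnion hc).mono fun x hx => ?_
  simpa using (mem_iSup_nat hs).1 hx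

theorem IsPartialIso.iSup {τ : Set (Γ × Γ)} {s : ℕ → Submodule ℚ (Γ × Γ)} (hs : Monotone s)
    (hP : ∀ n, IsPartialIso χ τ (s n)) : IsPartialIso χ τ (⨆ n, s n) := by
  refine ⟨countable_iSup_nat hs fun n => (hP n).countable, fun p hp => ?_, fun p hp => ?_⟩ <;>
    obtain ⟨n, hn⟩ := (mem_iSup_nat hs).1 hp
  · exact (hP n).pos_iff p hn
  · exact (hP n).chi_mem p hn

/-- A partial isomorphism extends to the elements of `χ(Γ^{<0})` in the domain of `τ`, when those
of its `χ`-values which come from `τ` come from its own elements. -/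
theorem IsPartialIso.exists_fill [PosSMulStrictMono ℚ Γ] (h : IsModelTpdg χ c) {τ : Set (Γ × Γ)}
    (ht : IsDeltaIso χ τ) (hτc : τ.Countable) {σ : Submodule ℚ (Γ × Γ)}
    (hs : IsPartialIso χ τ σ) (hnew : ∀ p ∈ σ, ∀ e ∈ τ, χ p.1 = χ e.1 → e ∈ σ) :
    ∃ σ', σ ≤ σ' ∧ IsPartialIso χ τ σ' ∧ ∀ e ∈ τ, e ∈ σ' := by
  have hp := h.precontraction
  suffices ∃ σ', σ ≤ σ' ∧ (IsPartialIso χ τ σ' ∧ ∀ p ∈ σ', ∀ e ∈ τ, χ p.1 = χ e.1 → e ∈ σ') ∧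
      ∀ e ∈ τ, e ∈ σ' by
    obtain ⟨σ', h1, h2, h3⟩ := this
    exact ⟨σ', h1, h2.1, h3⟩
  refine exists_iterated_extension
    (fun σ => IsPartialIso χ τ σ ∧ ∀ p ∈ σ, ∀ e ∈ τ, χ p.1 = χ e.1 → e ∈ σ) ?_
    (fun e σ => e ∈ σ) (fun _ _ _ hle hm => hle hm) τ hτc ?_ σ ⟨hs, hnew⟩
  · intro s hmono hP
    refine ⟨IsPartialIso.iSup hmono fun n => (hP n).1, fun p hpm e he hpe => ?_⟩
    obtain ⟨n, hn⟩ := (mem_iSup_nat hmono).1 hpm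
    exact (mem_iSup_nat hmono).2 ⟨n, (hP n).2 p hn e he hpe⟩
  rintro s ⟨hs, hnew⟩ e he
  by_cases hes : e ∈ s
  · exact ⟨s, le_rfl, ⟨hs, hnew⟩, hes⟩
  have he1 := h.neg_of_mem (ht.fst_mem e he)
  have he2 := h.neg_of_mem (ht.snd_mem e he)
  have hχe := ht.chi_mem e he
  have hχe1 := hp.map_neg_iff.2 he1
  have hχe2 := hp.map_neg_iff.2 he2
  -- As `e` is not yet in `s`, the invariant `hnew` excludes |χ(p.1)| = |χ(e.1)|. So one of `e`, `p`
  -- dominates the other, and by the same one on both coordinates because τ preserves order; sign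
  -- and χ-value of the sum are those of the dominant term.
  have hcases : ∀ p ∈ s, (χ (e.1 + p.1) = χ e.1 ∧ χ (e.2 + p.2) = χ e.2 ∧
      e.1 + p.1 < 0 ∧ e.2 + p.2 < 0) ∨ (χ (e.1 + p.1) = χ p.1 ∧ χ (e.2 + p.2) = χ p.2 ∧
      (0 < e.1 + p.1 ↔ 0 < e.2 + p.2) ∧ (e.1 + p.1 < 0 ↔ e.2 + p.2 < 0)) := by
    intro p hps
    rcases eq_or_ne p.1 0 with h0 | h0
    · have h0' := (hs.eq_zero_iff hps).1 h0
      left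
      rw [h0, h0', add_zero, add_zero]
      exact ⟨rfl, rfl, he1, he2⟩
    have h0' := mt (hs.eq_zero_iff hps).2 h0
    obtain ⟨f, hf, hf1, hf2⟩ : ∃ f ∈ τ, |χ p.1| = -f.1 ∧ |χ p.2| = -f.2 := by
      rcases hs.chi_mem p hps with hz | hm | hm
      · exact absurd ((hp.map_eq_zero_iff _).1 (congrArg Prod.fst hz)) h0
      · exact ⟨_, hm, abs_of_neg (h.neg_of_mem (ht.fst_mem _ hm)),
          abs_of_neg (h.neg_of_mem (ht.snd_mem _ hm))⟩
      · refine ⟨_, hm, ?_, ?_⟩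
        · have := h.neg_of_mem (ht.fst_mem _ hm)
          rw [← abs_neg]; exact abs_of_neg this
        · have := h.neg_of_mem (ht.snd_mem _ hm)
          rw [← abs_neg]; exact abs_of_neg this
    have hne : f.1 ≠ χ e.1 := by
      intro hfe
      have : |χ p.1| = |χ e.1| := by rw [hf1, hfe, abs_of_neg hχe1]
      rcases abs_eq_abs.1 this with h1 | h1
      · exact hes (hnew p hps e he h1)
      · refine hes (hnew (-p) (s.neg_mem hps) e he ?_)
        rw [Prod.fst_neg, hp.map_neg, h1, neg_neg]
    rcases lt_or_gt_of_ne hne with hlt | hlt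
    · right
      have hlt' := (ht.lt_iff f hf _ hχe).1 hlt
      have k1 : |χ e.1| < |χ p.1| := by rw [abs_of_neg hχe1, hf1]; exact neg_lt_neg hlt
      have k2 : |χ e.2| < |χ p.2| := by rw [abs_of_neg hχe2, hf2]; exact neg_lt_neg hlt'
      rcases lt_or_gt_of_ne h0 with hn | hn
      · have hn' := (hs.neg_iff hps).1 hn
        have l1 := hp.add_neg_of_dominated hn k1
        have l2 := hp.add_neg_of_dominated hn' k2
        exact ⟨l1.2, l2.2, iff_of_false l1.1.not_gt l2.1.not_gt, iff_of_true l1.1 l2.1⟩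
      · have hn' := (hs.pos_iff p hps).1 hn
        have l1 := hp.add_pos_of_dominated hn k1
        have l2 := hp.add_pos_of_dominated hn' k2
        exact ⟨l1.2, l2.2, iff_of_true l1.1 l2.1, iff_of_false l1.1.not_gt l2.1.not_gt⟩
    · left
      have hlt' := (ht.lt_iff _ hχe f hf).1 hlt
      have k1 : |χ p.1| < |χ e.1| := by rw [abs_of_neg hχe1, hf1]; exact neg_lt_neg hlt
      have k2 : |χ p.2| < |χ e.2| := by rw [abs_of_neg hχe2, hf2]; exact neg_lt_neg hlt'
      have l1 := hp.add_neg_of_dominated he1 k1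
      have l2 := hp.add_neg_of_dominated he2 k2
      rw [add_comm e.1, add_comm e.2]
      exact ⟨l1.2, l2.2, l1.1, l2.1⟩
  have hle : s ≤ s ⊔ Submodule.span ℚ {e} := le_sup_left
  have hemem : e ∈ s ⊔ Submodule.span ℚ {e} :=
    le_sup_right (a := s) (Submodule.mem_span_singleton_self e)
  refine ⟨s ⊔ Submodule.span ℚ {e}, hle, ⟨hs.adjoin h fun p hps => ?_, ?_⟩, hemem⟩
  · rcases hcases p hps with ⟨k1, k2, k3, k4⟩ | ⟨k1, k2, k3, k4⟩
    · rw [k1, k2]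
      exact ⟨iff_of_false k3.not_gt k4.not_gt, iff_of_true k3 k4, Or.inr (Or.inl hχe)⟩
    · rw [k1, k2]
      exact ⟨k3, k4, hs.chi_mem p hps⟩
  -- The invariant survives: up to a nonzero scalar, `x` is `e + p` or lies in `s`. The χ-value of
  -- `e + p` is that of `e`, which forces `f = e` by injectivity of χ on Δ, or that of `p`, where
  -- the invariant of `s` applies.
  · intro x hx f hf hxf
    obtain ⟨p, hps, y, hy, rfl⟩ := Submodule.mem_sup.1 hx
    obtain ⟨r, rfl⟩ := Submodule.mem_span_singleton.1 hy
    have hf1 := hp.map_neg_iff.2 (h.neg_of_mem (ht.fst_mem f hf))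
    have fin : ∀ p ∈ s, χ (e.1 + p.1) = χ f.1 ∨ χ (e.1 + p.1) = -χ f.1 →
        f ∈ s ⊔ Submodule.span ℚ {e} := by
      intro p hps hor
      rcases hcases p hps with ⟨k1, -, k3, -⟩ | ⟨k1, -, -, -⟩
      · rw [k1] at hor
        have hef : χ e.1 = χ f.1 := by
          refine hor.resolve_right fun hn => ?_
          rw [hn] at hχe1
          exact absurd (neg_lt_zero.1 hχe1) hf1.not_gt
        have h1 := h.chi_inj (ht.fst_mem e he) (ht.fst_mem f hf) hef
        have : e = f := Prod.ext h1 ((ht.eq_iff he hf).1 h1)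
        exact this ▸ hemem
      · rw [k1] at hor
        rcases hor with hor | hor
        · exact hle (hnew p hps f hf hor)
        · refine hle (hnew (-p) (s.neg_mem hps) f hf ?_)
          rw [Prod.fst_neg, hp.map_neg, hor, neg_neg]
    simp only [Prod.fst_add, Prod.smul_fst] at hxf
    rcases lt_trichotomy r 0 with hr | rfl | hr
    · refine fin (r⁻¹ • p) (s.smul_mem _ hps) (Or.inr ?_)
      have e1 : p.1 + r • e.1 = (-r) • (-(e.1 + (r⁻¹ • p).1)) := by
        rw [Prod.smul_fst, smul_neg, neg_smul, neg_neg, smul_add, smul_inv_smul₀ hr.ne, add_comm]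
      rw [e1, hp.map_smul_of_pos (neg_pos.2 hr), hp.map_neg] at hxf
      rw [← hxf, neg_neg]
    · exact hle (hnew p hps f hf (by simpa using hxf))
    · refine fin (r⁻¹ • p) (s.smul_mem _ hps) (Or.inl ?_)
      have e1 : p.1 + r • e.1 = r • (e.1 + (r⁻¹ • p).1) := by
        rw [Prod.smul_fst, smul_add, smul_inv_smul₀ hr.ne', add_comm]
      rw [e1, hp.map_smul_of_pos hr] at hxf
      exact hxf

end BackAndForth

/-! ### The forth property under countable saturation -/

section Extension

variable {Γ : Type u} [AddCommGroup Γ] [LinearOrder Γ] [IsOrderedAddMonoid Γ]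
  {χ : Γ → Γ} {c : Γ} [Module ℚ Γ]

/-- `σ` is the graph of an isomorphism between countable subspaces which contain `c` and are closed
under `χ` and `χ⁻¹`. -/
structure IsBackAndForth (χ : Γ → Γ) (c : Γ) (σ : Submodule ℚ (Γ × Γ)) : Prop where
  countable : (σ : Set (Γ × Γ)).Countable
  c_mem : (c, c) ∈ σ
  pos_iff : ∀ p ∈ σ, 0 < p.1 ↔ 0 < p.2
  chi_mem : ∀ p ∈ σ, (χ p.1, χ p.2) ∈ σ
  pred_mem : ∀ d ∈ chiNeg χ, ∀ d' ∈ chiNeg χ, (χ d, χ d') ∈ σ → (d, d') ∈ σ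

/-- The part of `σ` living on `χ(Γ^{<0})`. -/
def deltaPart (χ : Γ → Γ) (σ : Submodule ℚ (Γ × Γ)) : Set (Γ × Γ) :=
  {p | p ∈ σ ∧ p.1 ∈ chiNeg χ ∧ p.2 ∈ chiNeg χ}

/-- Conditions of the two kinds needed to extend isomorphisms are realized in `(Γ, χ)` as soon as
they are finitely satisfiable, if there are only countably many of them. -/
structure IsCountablySaturated (χ : Γ → Γ) : Prop where
  delta : ∀ A B : Set Γ, A.Countable → B.Countable →
    (∀ F G : Finset Γ, ↑F ⊆ A → ↑G ⊆ B →
      ∃ d ∈ chiNeg χ, (∀ a ∈ F, a < d) ∧ ∀ b ∈ G, d < b) →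
    ∃ d ∈ chiNeg χ, (∀ a ∈ A, a < d) ∧ ∀ b ∈ B, d < b
  gap : ∀ A B : Set (Γ × Γ), A.Countable → B.Countable →
    (∀ F G : Finset (Γ × Γ), ↑F ⊆ A → ↑G ⊆ B →
      ∃ x, (∀ a ∈ F, a.1 < x ∧ χ (x - a.1) = a.2) ∧ ∀ b ∈ G, x < b.1 ∧ χ (b.1 - x) = b.2) →
    ∃ x, (∀ a ∈ A, a.1 < x ∧ χ (x - a.1) = a.2) ∧ ∀ b ∈ B, x < b.1 ∧ χ (b.1 - x) = b.2

namespace IsBackAndForth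

variable {σ : Submodule ℚ (Γ × Γ)}

theorem lt_iff (hs : IsBackAndForth χ c σ) {p q : Γ × Γ} (hp : p ∈ σ) (hq : q ∈ σ) :
    p.1 < q.1 ↔ p.2 < q.2 := by
  simpa using hs.pos_iff (q - p) (σ.sub_mem hq hp)

theorem eq_iff (hs : IsBackAndForth χ c σ) {p q : Γ × Γ} (hp : p ∈ σ) (hq : q ∈ σ) :
    p.1 = q.1 ↔ p.2 = q.2 := by
  have h1 := hs.lt_iff hp hq
  have h2 := hs.lt_iff hq hp
  constructor
  · intro h
    exact le_antisymm (not_lt.1 fun h' => (h2.2 h').ne' h) (not_lt.1 fun h' => (h1.2 h').ne h)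
  · intro h
    exact le_antisymm (not_lt.1 fun h' => (h2.1 h').ne' h) (not_lt.1 fun h' => (h1.1 h').ne h)

theorem neg_iff (hs : IsBackAndForth χ c σ) {p : Γ × Γ} (hp : p ∈ σ) : p.1 < 0 ↔ p.2 < 0 :=
  hs.lt_iff hp σ.zero_mem

theorem eq_of_fst_eq (hs : IsBackAndForth χ c σ) {a b b' : Γ} (h : (a, b) ∈ σ)
    (h' : (a, b') ∈ σ) : b = b' := (hs.eq_iff h h').1 rfl

theorem swap (hs : IsBackAndForth χ c σ) :
    IsBackAndForth χ c (σ.comap (LinearEquiv.prodComm ℚ Γ Γ).toLinearMap) := by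
  refine ⟨?_, hs.c_mem, fun p hp => (hs.pos_iff _ hp).symm, fun p hp => hs.chi_mem _ hp,
    fun d hd d' hd' hm => hs.pred_mem d' hd' d hd hm⟩
  exact hs.countable.preimage (f := fun p : Γ × Γ => p.swap) Prod.swap_injective

theorem max_mem (hs : IsBackAndForth χ c σ) {p q : Γ × Γ} (hp : p ∈ σ) (hq : q ∈ σ) :
    (max p.1 q.1, max p.2 q.2) ∈ σ := by
  rcases le_total p.1 q.1 with hle | hle
  · have := not_lt.1 (mt (hs.lt_iff hq hp).2 hle.not_gt)
    rwa [max_eq_right hle, max_eq_right this]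
  · have := not_lt.1 (mt (hs.lt_iff hp hq).2 hle.not_gt)
    rwa [max_eq_left hle, max_eq_left this]

/-- Partial isomorphisms match elements of `χ(Γ)`. -/
theorem snd_mem (h : IsModelTpdg χ c) (hs : IsBackAndForth χ c σ) {p : Γ × Γ} (hp : p ∈ σ)
    (hd : p.1 ∈ chiNeg χ) : p.2 ∈ chiNeg χ := by
  have h1 := h.neg_of_mem hd
  have h2 := (hs.neg_iff hp).1 h1
  have h3 := hs.chi_mem p hp
  -- The isomorphism fixes `c` and preserves order, so χ(p.2) has a predecessor in Δ. Closure under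
  -- predecessors matches it with `p.1`, and single-valuedness identifies it with `p.2`.
  have h4 : c < χ p.2 := (hs.lt_iff hs.c_mem h3).1 (h.c_lt_chi hd)
  obtain ⟨e, he, hep⟩ := h.exists_pred ⟨p.2, h2, rfl⟩ h4
  rw [← hep] at h3
  have h5 := hs.pred_mem p.1 hd e he h3
  rw [hs.eq_of_fst_eq hp h5]
  exact he

theorem isDeltaIso (h : IsModelTpdg χ c) (hs : IsBackAndForth χ c σ) :
    IsDeltaIso χ (deltaPart χ σ) where
  fst_mem _ he := he.2.1
  snd_mem _ he := he.2.2
  lt_iff _ he _ hf := hs.lt_iff he.1 hf.1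
  chi_mem e he := ⟨hs.chi_mem e he.1, h.chi_mem he.2.1, h.chi_mem he.2.2⟩
  pred_mem d hd d' hd' hm := ⟨hs.pred_mem d hd d' hd' hm.1, hd, hd'⟩

theorem mem_oddExt (h : IsModelTpdg χ c) (hs : IsBackAndForth χ c σ) {x y : Γ}
    (hp : (χ x, χ y) ∈ σ) : (χ x, χ y) ∈ oddExt (deltaPart χ σ) := by
  have hpr := h.precontraction
  have h1 := hs.lt_iff hp σ.zero_mem
  have h2 := hs.lt_iff σ.zero_mem hp
  simp only [Prod.fst_zero, Prod.snd_zero] at h1 h2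
  rw [hpr.map_neg_iff, hpr.map_neg_iff] at h1
  rw [hpr.map_pos_iff, hpr.map_pos_iff] at h2
  rcases lt_trichotomy x 0 with hx | hx | hx
  · exact Or.inr (Or.inl ⟨hp, ⟨x, hx, rfl⟩, ⟨y, h1.1 hx, rfl⟩⟩)
  · left
    have hy : y = 0 := le_antisymm (not_lt.1 fun h' => (h2.2 h').ne' hx)
      (not_lt.1 fun h' => (h1.2 h').ne hx)
    rw [hx, hy, hpr.map_zero]; rfl
  · refine Or.inr (Or.inr ⟨σ.neg_mem hp, ⟨-x, neg_lt_zero.2 hx, hpr.map_neg x⟩,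
      ⟨-y, neg_lt_zero.2 (h2.1 hx), hpr.map_neg y⟩⟩)

theorem isPartialIso (h : IsModelTpdg χ c) (hs : IsBackAndForth χ c σ) :
    IsPartialIso χ (deltaPart χ σ) σ :=
  ⟨hs.countable, hs.pos_iff, fun p hp => hs.mem_oddExt h (hs.chi_mem p hp)⟩

theorem iSup {s : ℕ → Submodule ℚ (Γ × Γ)} (hs : Monotone s)
    (hP : ∀ n, IsBackAndForth χ c (s n)) : IsBackAndForth χ c (⨆ n, s n) where
  countable := countable_iSup_nat hs fun n => (hP n).countable
  c_mem := (mem_iSup_nat hs).2 ⟨0, (hP 0).c_mem⟩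
  pos_iff p hp := by
    obtain ⟨n, hn⟩ := (mem_iSup_nat hs).1 hp
    exact (hP n).pos_iff p hn
  chi_mem p hp := by
    obtain ⟨n, hn⟩ := (mem_iSup_nat hs).1 hp
    exact (mem_iSup_nat hs).2 ⟨n, (hP n).chi_mem p hn⟩
  pred_mem d hd d' hd' hm := by
    obtain ⟨n, hn⟩ := (mem_iSup_nat hs).1 hm
    exact (mem_iSup_nat hs).2 ⟨n, (hP n).pred_mem d hd d' hd' hn⟩

end IsBackAndForth

theorem IsPartialIso.isBackAndForth (h : IsModelTpdg χ c) {τ : Set (Γ × Γ)}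
    (ht : IsDeltaIso χ τ) {σ : Submodule ℚ (Γ × Γ)} (hs : IsPartialIso χ τ σ)
    (hτ : ∀ e ∈ τ, e ∈ σ) (hc : (c, c) ∈ σ) : IsBackAndForth χ c σ where
  countable := hs.countable
  c_mem := hc
  pos_iff := hs.pos_iff
  chi_mem p hp := by
    rcases hs.chi_mem p hp with h0 | hm | hm
    · rw [h0]; exact σ.zero_mem
    · exact hτ _ hm
    · simpa using σ.neg_mem (hτ _ hm)
  pred_mem d hd d' hd' hm := by
    -- Being in σ only puts the χ-values of a pair into the odd extension of τ. So χ is applied once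
    -- more, and two predecessors are taken inside τ.
    have h1 := hs.chi_mem _ hm
    have h2 := mem_of_mem_oddExt h ht h1 (h.neg_of_mem (h.chi_mem (h.chi_mem hd)))
    exact hτ _ (ht.pred_mem d hd d' hd' (ht.pred_mem _ (h.chi_mem hd) _ (h.chi_mem hd') h2))

/-- The pairs obtained from `(d, d')` by passing to successors and predecessors. -/
def chainSet (χ : Γ → Γ) (d d' : Γ) : Set (Γ × Γ) :=
  {e | e.1 ∈ chiNeg χ ∧ e.2 ∈ chiNeg χ ∧ ∃ m n : ℕ, χ^[m] e.1 = χ^[n] d ∧ χ^[m] e.2 = χ^[n] d'}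

/-- A pair is determined by its exponents `(m, n)`, since iterates of χ are injective on Δ. -/
theorem countable_chainSet (h : IsModelTpdg χ c) (d d' : Γ) : (chainSet χ d d').Countable := by
  have : ∀ e : chainSet χ d d', ∃ k : ℕ × ℕ, χ^[k.1] e.1.1 = χ^[k.2] d ∧
      χ^[k.1] e.1.2 = χ^[k.2] d' := fun e => by
    obtain ⟨-, -, m, n, hmn⟩ := e.2
    exact ⟨(m, n), hmn⟩
  choose k hk1 hk2 using this
  have hinj : Function.Injective k := by
    intro e f hef
    refine Subtype.ext (Prod.ext ?_ ?_)
    · exact h.iterate_inj e.2.1 f.2.1 (n := (k e).1) (by rw [hk1 e, hef, hk1 f])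
    · exact h.iterate_inj e.2.2.1 f.2.2.1 (n := (k e).1) (by rw [hk2 e, hef, hk2 f])
  exact Set.countable_coe_iff.1 hinj.countable

namespace IsBackAndForth

variable {σ : Submodule ℚ (Γ × Γ)}

/-- Because the old domain is closed under successors and predecessors, the iterates of `d` and `d'`
again realize corresponding cuts. A chain element is compared with an old one by applying a power of
χ to both, which turns the chain element into such an iterate. -/
theorem isDeltaIso_union_chainSet (h : IsModelTpdg χ c) (hs : IsBackAndForth χ c σ) {d d' : Γ}
    (hd : d ∈ chiNeg χ) (hd' : d' ∈ chiNeg χ)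
    (hcut : ∀ e ∈ deltaPart χ σ, (e.1 < d ∧ e.2 < d') ∨ (d < e.1 ∧ d' < e.2)) :
    IsDeltaIso χ (deltaPart χ σ ∪ chainSet χ d d') := by
  have ht := hs.isDeltaIso h
  have hiter : ∀ e ∈ deltaPart χ σ, ∀ n, (χ^[n] e.1, χ^[n] e.2) ∈ deltaPart χ σ := by
    intro e he n
    induction n with
    | zero => exact he
    | succ n ih =>
      rw [Function.iterate_succ_apply', Function.iterate_succ_apply']
      exact ht.chi_mem _ ih
  have hcut2 : ∀ n : ℕ, ∀ e ∈ deltaPart χ σ,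
      (e.1 < χ^[n] d ∧ e.2 < χ^[n] d') ∨ (χ^[n] d < e.1 ∧ χ^[n] d' < e.2) := by
    intro n
    induction n with
    | zero => exact hcut
    | succ n ih =>
      intro e he
      rw [Function.iterate_succ_apply', Function.iterate_succ_apply']
      have hdn := h.iterate_mem hd n
      have hdn' := h.iterate_mem hd' n
      rcases ih e he with ⟨h1, h2⟩ | ⟨h1, h2⟩
      · exact Or.inl ⟨h1.trans (h.lt_chi (h.neg_of_mem hdn)),
          h2.trans (h.lt_chi (h.neg_of_mem hdn'))⟩
      -- The successor of the iterate of `d` is at most `e.1`. Equality would make that iterate the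
      -- predecessor of `e.1`, which belongs to the old domain and so differs from it by `ih`. The
      -- second coordinate is analogous.
      · right
        have l1 := h.chi_le hdn he.2.1 h1
        have l2 := h.chi_le hdn' he.2.2 h2
        have hce := (h.c_le hdn).trans_lt h1
        have hce' := (h.c_le hdn').trans_lt h2
        obtain ⟨f, hf, hfe⟩ := h.exists_pred he.2.1 hce
        obtain ⟨f', hf', hfe'⟩ := h.exists_pred he.2.2 hce'
        have hff : (f, f') ∈ deltaPart χ σ := by
          refine ht.pred_mem f hf f' hf' ?_
          rw [hfe, hfe']; exact he
        refine ⟨lt_of_le_of_ne l1 fun heq => ?_, lt_of_le_of_ne l2 fun heq => ?_⟩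
        · have := h.chi_inj hdn hf (heq.trans hfe.symm)
          rcases ih _ hff with k | k
          · exact k.1.ne this.symm
          · exact k.1.ne this
        · have := h.chi_inj hdn' hf' (heq.trans hfe'.symm)
          rcases ih _ hff with k | k
          · exact k.2.ne this.symm
          · exact k.2.ne this
  have hmix : ∀ e ∈ deltaPart χ σ, ∀ f ∈ chainSet χ d d',
      (e.1 < f.1 ↔ e.2 < f.2) ∧ (f.1 < e.1 ↔ f.2 < e.2) := by
    rintro e he f ⟨hf1, hf2, m, n, h1, h2⟩
    rw [← h.iterate_lt_iterate he.2.1 hf1 m, ← h.iterate_lt_iterate he.2.2 hf2 m,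
      ← h.iterate_lt_iterate hf1 he.2.1 m, ← h.iterate_lt_iterate hf2 he.2.2 m, h1, h2]
    rcases hcut2 n _ (hiter e he m) with k | k
    · exact ⟨iff_of_true k.1 k.2, iff_of_false k.1.not_gt k.2.not_gt⟩
    · exact ⟨iff_of_false k.1.not_gt k.2.not_gt, iff_of_true k.1 k.2⟩
  refine ⟨?_, ?_, ?_, ?_, ?_⟩
  · rintro e (he | he)
    exacts [he.2.1, he.1]
  · rintro e (he | he)
    exacts [he.2.2, he.2.1]
  · rintro e (he | he) f (hf | hf)
    · exact ht.lt_iff e he f hf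
    · exact (hmix e he f hf).1
    · exact (hmix f hf e he).2
    · obtain ⟨he1, he2, m, n, h1, h2⟩ := he
      obtain ⟨hf1, hf2, m', n', h1', h2'⟩ := hf
      -- After `m + m'` applications of χ both elements are iterates of `d` (or of `d'`), so on
      -- either coordinate only the exponents `m' + n` and `m + n'` are compared.
      rw [← h.iterate_lt_iterate he1 hf1 (m + m'), ← h.iterate_lt_iterate he2 hf2 (m + m')]
      have e1 : ∀ {x z : Γ}, χ^[m] x = χ^[n] z → χ^[m + m'] x = χ^[m' + n] z := fun hx => by
        rw [add_comm, Function.iterate_add_apply, hx, ← Function.iterate_add_apply]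
      have e2 : ∀ {x z : Γ}, χ^[m'] x = χ^[n'] z → χ^[m + m'] x = χ^[m + n'] z := fun hx => by
        rw [Function.iterate_add_apply, hx, ← Function.iterate_add_apply]
      rw [e1 h1, e1 h2, e2 h1', e2 h2', (h.iterate_strictMono hd).lt_iff_lt,
        (h.iterate_strictMono hd').lt_iff_lt]
  · rintro e (he | ⟨he1, he2, m, n, h1, h2⟩)
    · exact Or.inl (ht.chi_mem e he)
    · refine Or.inr ⟨h.chi_mem he1, h.chi_mem he2, m, n + 1, ?_, ?_⟩
      · rw [← Function.iterate_succ_apply, Function.iterate_succ_apply', h1,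
          Function.iterate_succ_apply']
      · rw [← Function.iterate_succ_apply, Function.iterate_succ_apply', h2,
          Function.iterate_succ_apply']
  · rintro e he e' he' (hm | ⟨-, -, m, n, h1, h2⟩)
    · exact Or.inl (ht.pred_mem e he e' he' hm)
    · exact Or.inr ⟨he, he', m + 1, n, h1, h2⟩

/-- Two elements of `χ(Γ^{<0})` realizing corresponding cuts can be matched. -/
theorem exists_extension_of_cut [PosSMulStrictMono ℚ Γ] (h : IsModelTpdg χ c)
    (hs : IsBackAndForth χ c σ) {d d' : Γ} (hd : d ∈ chiNeg χ) (hd' : d' ∈ chiNeg χ)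
    (hcut : ∀ e ∈ deltaPart χ σ, (e.1 < d ∧ e.2 < d') ∨ (d < e.1 ∧ d' < e.2)) :
    ∃ σ', σ ≤ σ' ∧ IsBackAndForth χ c σ' ∧ (d, d') ∈ σ' := by
  have ht := hs.isDeltaIso_union_chainSet h hd hd' hcut
  have hsub : deltaPart χ σ ⊆ deltaPart χ σ ∪ chainSet χ d d' := Set.subset_union_left
  have hp := hs.isPartialIso h
  have hp' : IsPartialIso χ (deltaPart χ σ ∪ chainSet χ d d') σ :=
    ⟨hs.countable, hs.pos_iff, fun p hpm => oddExt_mono hsub (hp.chi_mem p hpm)⟩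
  have hcount : (deltaPart χ σ ∪ chainSet χ d d').Countable :=
    (hs.countable.mono fun p hpm => hpm.1).union (countable_chainSet h d d')
  -- If a χ-value from σ equals χ(e.1), then the pair of χ-values of `e` is already in σ, and
  -- closure under predecessors puts `e` there.
  obtain ⟨σ', hle, hσ', hτ⟩ := hp'.exists_fill h ht hcount fun p hpm e he hpe => by
    have k1 := ht.chi_mem e he
    have hneg : χ p.1 < 0 := hpe ▸ h.neg_of_mem (ht.fst_mem _ k1)
    have k2 := mem_of_mem_oddExt h (hs.isDeltaIso h) (hp.chi_mem p hpm) hneg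
    have k3 : χ p.2 = χ e.2 := (ht.eq_iff (hsub k2) k1).1 hpe
    have k4 := k2.1
    rw [hpe, k3] at k4
    exact hs.pred_mem e.1 (ht.fst_mem e he) e.2 (ht.snd_mem e he) k4
  refine ⟨σ', hle, hσ'.isBackAndForth h ht hτ (hle hs.c_mem), hτ _ (Or.inr ⟨hd, hd', 0, 0, rfl, rfl⟩)⟩

theorem exists_extension_delta [PosSMulStrictMono ℚ Γ] (h : IsModelTpdg χ c)
    (hsat : IsCountablySaturated χ) (hs : IsBackAndForth χ c σ) {d : Γ} (hd : d ∈ chiNeg χ) :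
    ∃ σ', σ ≤ σ' ∧ IsBackAndForth χ c σ' ∧ ∃ d', (d, d') ∈ σ' := by
  by_cases hdom : ∃ d', (d, d') ∈ σ
  · exact ⟨σ, le_rfl, hs, hdom⟩
  push Not at hdom
  have hne : ∀ e ∈ deltaPart χ σ, e.1 ≠ d := fun e he heq => hdom e.2 (heq ▸ he.1)
  have hcount : (deltaPart χ σ).Countable := hs.countable.mono fun p hpm => hpm.1
  have hc : (c, c) ∈ deltaPart χ σ := ⟨hs.c_mem, h.c_mem, h.c_mem⟩
  have hcd : c < d := lt_of_le_of_ne (h.c_le hd) (hne _ hc)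
  obtain ⟨d', hd', hA, hB⟩ := hsat.delta (Prod.snd '' {e ∈ deltaPart χ σ | e.1 < d})
    (Prod.snd '' {e ∈ deltaPart χ σ | d < e.1})
    ((hcount.mono fun p hpm => hpm.1).image _) ((hcount.mono fun p hpm => hpm.1).image _) (by
      intro F G hF hG
      classical
      -- Inserting `c` guarantees a point below the cut. The witness for the finite set is the
      -- successor of the largest such point: on the domain side it is at most `d`, and not equal to
      -- `d`, which is outside the domain.
      obtain ⟨m, hmF, hmax⟩ := Finset.exists_max_image (insert c F) id ⟨c, Finset.mem_insert_self _ _⟩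
      obtain ⟨e, ⟨he, hed⟩, rfl⟩ : m ∈ Prod.snd '' {e ∈ deltaPart χ σ | e.1 < d} := by
        rcases Finset.mem_insert.1 hmF with rfl | hm
        · exact ⟨_, ⟨hc, hcd⟩, rfl⟩
        · exact hF hm
      have hχe := (hs.isDeltaIso h).chi_mem e he
      refine ⟨χ e.2, h.chi_mem he.2.2, fun a ha => ?_, fun b hb => ?_⟩
      · exact lt_of_le_of_lt (hmax a (Finset.mem_insert_of_mem ha))
          (h.lt_chi (h.neg_of_mem he.2.2))
      · obtain ⟨f, ⟨hf, hdf⟩, rfl⟩ := hG hb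
        refine (hs.lt_iff hχe.1 hf.1).1 (lt_of_lt_of_le ?_ hdf.le)
        exact lt_of_le_of_ne (h.chi_le he.2.1 hd hed) (hne _ hχe))
  obtain ⟨σ', hle, hσ', hm⟩ := hs.exists_extension_of_cut h hd hd' fun e he => by
    rcases lt_or_gt_of_ne (hne e he) with hlt | hlt
    · exact Or.inl ⟨hlt, hA _ ⟨e, ⟨he, hlt⟩, rfl⟩⟩
    · exact Or.inr ⟨hlt, hB _ ⟨e, ⟨he, hlt⟩, rfl⟩⟩
  exact ⟨σ', hle, hσ', d', hm⟩

theorem exists_extension_deltaSet [PosSMulStrictMono ℚ Γ] (h : IsModelTpdg χ c)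
    (hsat : IsCountablySaturated χ) (hs : IsBackAndForth χ c σ) {D : Set Γ} (hD : D.Countable)
    (hsub : D ⊆ chiNeg χ) :
    ∃ σ', σ ≤ σ' ∧ IsBackAndForth χ c σ' ∧ ∀ d ∈ D, ∃ d', (d, d') ∈ σ' := by
  refine exists_iterated_extension (fun σ => IsBackAndForth χ c σ) (fun s hm hP => .iSup hm hP)
    (fun d σ => ∃ d', (d, d') ∈ σ) ?_ D hD ?_ σ hs
  · rintro d s t hst ⟨d', hd'⟩
    exact ⟨d', hst hd'⟩
  · intro s hs d hd
    exact hs.exists_extension_delta h hsat (hsub hd)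

/-- The domain of an isomorphism can be made to contain the `χ`-values of the distances of its
elements to a given element. -/
theorem exists_extension_distances [PosSMulStrictMono ℚ Γ] (h : IsModelTpdg χ c)
    (hsat : IsCountablySaturated χ) (hs : IsBackAndForth χ c σ) (b : Γ) :
    ∃ σ', σ ≤ σ' ∧ IsBackAndForth χ c σ' ∧ ∀ p ∈ σ', ∃ s, (χ (b - p.1), s) ∈ σ' := by
  have hpr := h.precontraction
  have step : ∀ s, IsBackAndForth χ c s → ∃ t, s ≤ t ∧ IsBackAndForth χ c t ∧
      ∀ p ∈ s, ∃ x, (χ (b - p.1), x) ∈ t := by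
    intro s hs
    obtain ⟨t, hle, ht, hD⟩ := hs.exists_extension_deltaSet h hsat
      -- The sign is normalized so that nonzero values lie in Δ; the intersection discards the value
      -- 0.
      (D := (fun p : Γ × Γ => -|χ (b - p.1)|) '' s ∩ chiNeg χ)
      ((hs.countable.image _).mono Set.inter_subset_left) Set.inter_subset_right
    refine ⟨t, hle, ht, fun p hp => ?_⟩
    rcases lt_trichotomy (b - p.1) 0 with hx | hx | hx
    · refine hD _ ⟨⟨p, hp, ?_⟩, ⟨_, hx, rfl⟩⟩
      simp only
      rw [abs_of_neg (hpr.map_neg_iff.2 hx), neg_neg]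
    · exact ⟨0, by rw [hx, hpr.map_zero]; exact t.zero_mem⟩
    · have he : -|χ (b - p.1)| = -χ (b - p.1) := by rw [abs_of_pos (hpr.map_pos_iff.2 hx)]
      obtain ⟨d', hd'⟩ := hD (-χ (b - p.1)) ⟨⟨p, hp, he⟩, ⟨_, neg_lt_zero.2 hx, hpr.map_neg _⟩⟩
      exact ⟨-d', by simpa using t.neg_mem hd'⟩
  -- Each enlargement of the domain creates new distances to `b`, so the step is repeated countably
  -- often.
  choose! g hg1 hg2 hg3 using step
  let S : ℕ → Submodule ℚ (Γ × Γ) := fun n => Nat.rec σ (fun _ t => g t) n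
  have hS : ∀ n, IsBackAndForth χ c (S n) := fun n => by
    induction n with
    | zero => exact hs
    | succ n ih => exact hg2 _ ih
  have hmono : Monotone S := monotone_nat_of_le_succ fun n => hg1 _ (hS n)
  refine ⟨⨆ n, S n, le_iSup S 0, .iSup hmono hS, fun p hp => ?_⟩
  obtain ⟨n, hn⟩ := (mem_iSup_nat hmono).1 hp
  obtain ⟨x, hx⟩ := hg3 _ (hS n) p hn
  exact ⟨x, (mem_iSup_nat hmono).2 ⟨n + 1, hx⟩⟩

/-- For each `p` in the domain, the side of `b` and the value χ(b - p.1) fix the sign and χ-value of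
that difference. Transferred along σ they become countably many gap conditions. The nearest
condition on each side implies the others, because χ of a sum of nonnegative elements is a maximum,
and two opposite conditions are met by `exists_between`. -/
theorem exists_extension_of_distances [PosSMulStrictMono ℚ Γ] (h : IsModelTpdg χ c)
    (hsat : IsCountablySaturated χ) (hs : IsBackAndForth χ c σ) {b : Γ}
    (hb : ∀ p ∈ σ, p.1 ≠ b) (hdist : ∀ p ∈ σ, ∃ s, (χ (b - p.1), s) ∈ σ) :
    ∃ σ', σ ≤ σ' ∧ IsBackAndForth χ c σ' ∧ ∃ b', (b, b') ∈ σ' := by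
  have hpr := h.precontraction
  let A : Set (Γ × Γ) := {a | ∃ p ∈ σ, p.2 = a.1 ∧ p.1 < b ∧ (χ (b - p.1), a.2) ∈ σ}
  let B : Set (Γ × Γ) := {a | ∃ p ∈ σ, p.2 = a.1 ∧ b < p.1 ∧ (χ (p.1 - b), a.2) ∈ σ}
  have hcount : ((Prod.snd '' (σ : Set (Γ × Γ))) ×ˢ (Prod.snd '' (σ : Set (Γ × Γ)))).Countable :=
    (hs.countable.image _).prod (hs.countable.image _)
  have hA : A.Countable := hcount.mono (by
    rintro a ⟨p, hp, hpa, -, hm⟩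
    exact ⟨⟨p, hp, hpa⟩, ⟨_, hm, rfl⟩⟩)
  have hB : B.Countable := hcount.mono (by
    rintro a ⟨p, hp, hpa, -, hm⟩
    exact ⟨⟨p, hp, hpa⟩, ⟨_, hm, rfl⟩⟩)
  -- widths occurring in the conditions are values of `χ`
  have hwidth : ∀ {x s : Γ}, 0 < x → (χ x, s) ∈ σ → ∃ z, 0 < z ∧ χ z = s := by
    intro x s hx hm
    have hmem : -χ x ∈ chiNeg χ := ⟨-x, neg_lt_zero.2 hx, hpr.map_neg x⟩
    obtain ⟨y, hy, hys⟩ := hs.snd_mem h (σ.neg_mem hm) hmem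
    exact ⟨-y, neg_pos.2 hy, by rw [hpr.map_neg, hys]; simp⟩
  -- a condition implies those which are further away
  have hlow : ∀ {a a' : Γ × Γ} {x : Γ}, a ∈ A → a' ∈ A → a'.1 ≤ a.1 → a.1 < x →
      χ (x - a.1) = a.2 → a'.1 < x ∧ χ (x - a'.1) = a'.2 := by
    rintro a a' x ⟨p, hp, hpa, hpb, hpm⟩ ⟨p', hp', hpa', hpb', hpm'⟩ hle hx hχ
    rw [← hpa] at hle hx hχ
    rw [← hpa'] at hle ⊢
    refine ⟨hle.trans_lt hx, ?_⟩
    have hle1 : p'.1 ≤ p.1 := not_lt.1 (mt (hs.lt_iff hp hp').1 hle.not_gt)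
    have e1 : b - p'.1 = (b - p.1) + (p.1 - p'.1) := by abel
    have e2 : x - p'.2 = (x - p.2) + (p.2 - p'.2) := by abel
    rw [e1, hpr.map_add_of_nonneg (sub_nonneg.2 hpb.le) (sub_nonneg.2 hle1)] at hpm'
    rw [e2, hpr.map_add_of_nonneg (sub_nonneg.2 hx.le) (sub_nonneg.2 hle), hχ]
    exact hs.eq_of_fst_eq (hs.max_mem hpm (hs.chi_mem _ (σ.sub_mem hp hp'))) hpm'
  have hupp : ∀ {a a' : Γ × Γ} {x : Γ}, a ∈ B → a' ∈ B → a.1 ≤ a'.1 → x < a.1 →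
      χ (a.1 - x) = a.2 → x < a'.1 ∧ χ (a'.1 - x) = a'.2 := by
    rintro a a' x ⟨p, hp, hpa, hpb, hpm⟩ ⟨p', hp', hpa', hpb', hpm'⟩ hle hx hχ
    rw [← hpa] at hle hx hχ
    rw [← hpa'] at hle ⊢
    refine ⟨hx.trans_le hle, ?_⟩
    have hle1 : p.1 ≤ p'.1 := not_lt.1 (mt (hs.lt_iff hp' hp).1 hle.not_gt)
    have e1 : p'.1 - b = (p.1 - b) + (p'.1 - p.1) := by abel
    have e2 : p'.2 - x = (p.2 - x) + (p'.2 - p.2) := by abel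
    rw [e1, hpr.map_add_of_nonneg (sub_nonneg.2 hpb.le) (sub_nonneg.2 hle1)] at hpm'
    rw [e2, hpr.map_add_of_nonneg (sub_nonneg.2 hx.le) (sub_nonneg.2 hle), hχ]
    exact hs.eq_of_fst_eq (hs.max_mem hpm (hs.chi_mem _ (σ.sub_mem hp' hp))) hpm'
  obtain ⟨b', hbA, hbB⟩ := hsat.gap A B hA hB (by
    intro F G hF hG
    rcases F.eq_empty_or_nonempty with rfl | hFne
    · rcases G.eq_empty_or_nonempty with rfl | hGne
      · exact ⟨0, by simp, by simp⟩
      obtain ⟨w, hwG, hwmin⟩ := Finset.exists_min_image G Prod.fst hGne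
      obtain ⟨p, hp, hpw, hpb, hpm⟩ := hG hwG
      obtain ⟨z, hz, hzw⟩ := hwidth (sub_pos.2 hpb) hpm
      refine ⟨w.1 - z, by simp, fun a ha => hupp (hG hwG) (hG ha) (hwmin a ha) ?_ ?_⟩
      · simpa using hz
      · simpa using hzw
    obtain ⟨u, huF, humax⟩ := Finset.exists_max_image F Prod.fst hFne
    obtain ⟨p, hp, hpu, hpb, hpm⟩ := hF huF
    obtain ⟨z, hz, hzu⟩ := hwidth (sub_pos.2 hpb) hpm
    rcases G.eq_empty_or_nonempty with rfl | hGne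
    · refine ⟨u.1 + z, fun a ha => hlow (hF huF) (hF ha) (humax a ha) ?_ ?_, by simp⟩
      · simpa using hz
      · simpa using hzu
    obtain ⟨w, hwG, hwmin⟩ := Finset.exists_min_image G Prod.fst hGne
    obtain ⟨q, hq, hqw, hqb, hqm⟩ := hG hwG
    obtain ⟨z₂, hz₂, hzw⟩ := hwidth (sub_pos.2 hqb) hqm
    have huw : u.1 < w.1 := by
      rw [← hpu, ← hqw]
      exact (hs.lt_iff hp hq).1 (hpb.trans hqb)
    -- On the domain side `b` splits the gap, so the width of the gap is the maximum of the two; σ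
    -- carries this identity to the image.
    have hmax : χ (w.1 - u.1) = max (χ z) (χ z₂) := by
      rw [hzu, hzw]
      have e : q.1 - p.1 = (b - p.1) + (q.1 - b) := by abel
      have k := hs.chi_mem _ (σ.sub_mem hq hp)
      simp only [Prod.fst_sub, Prod.snd_sub] at k
      rw [e, hpr.map_add_of_nonneg (sub_pos.2 hpb).le (sub_pos.2 hqb).le, hqw, hpu] at k
      exact hs.eq_of_fst_eq k (hs.max_mem hpm hqm)
    obtain ⟨x, hx1, hx2, hx3, hx4⟩ := h.exists_between huw hz hz₂ hmax
    exact ⟨x, fun a ha => hlow (hF huF) (hF ha) (humax a ha) hx1 (hx3.trans hzu),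
      fun a ha => hupp (hG hwG) (hG ha) (hwmin a ha) hx2 (hx4.trans hzw)⟩)
  have hp := hs.isPartialIso h
  have key : IsPartialIso χ (deltaPart χ σ) (σ ⊔ Submodule.span ℚ {(b, b')}) := by
    refine hp.adjoin h fun p hpm => ?_
    -- `adjoin` asks about sums with `p`, the conditions speak of differences, so they are used at
    -- `-p`.
    have hn := σ.neg_mem hpm
    obtain ⟨s, hsm⟩ := hdist _ hn
    have e1 : b + p.1 = b - (-p).1 := by simp
    have e2 : b' + p.2 = b' - (-p).2 := by simp
    simp only
    rw [e1, e2, sub_pos, sub_pos, sub_neg, sub_neg]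
    rcases lt_or_gt_of_ne (hb _ hn) with hlt | hlt
    · obtain ⟨k1, k2⟩ := hbA ((-p).2, s) ⟨-p, hn, rfl, hlt, hsm⟩
      refine ⟨iff_of_true hlt k1, iff_of_false hlt.not_gt k1.not_gt, hs.mem_oddExt h ?_⟩
      simp only at k2
      rw [k2]; exact hsm
    · have hsm' : (χ ((-p).1 - b), -s) ∈ σ := by
        rw [← neg_sub, hpr.map_neg]; exact σ.neg_mem hsm
      obtain ⟨k1, k2⟩ := hbB ((-p).2, -s) ⟨-p, hn, rfl, hlt, hsm'⟩
      refine ⟨iff_of_false hlt.not_gt k1.not_gt, iff_of_true hlt k1, hs.mem_oddExt h ?_⟩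
      simp only at k2
      rw [← neg_sub, hpr.map_neg, neg_inj] at k2
      rw [k2]; exact hsm
  have hle : σ ≤ σ ⊔ Submodule.span ℚ {(b, b')} := le_sup_left
  exact ⟨_, hle, key.isBackAndForth h (hs.isDeltaIso h) (fun e he => hle he.1) (hle hs.c_mem), b',
    le_sup_right (a := σ) (Submodule.mem_span_singleton_self _)⟩

/-- The forth property. -/
theorem exists_forth [PosSMulStrictMono ℚ Γ] (h : IsModelTpdg χ c)
    (hsat : IsCountablySaturated χ) (hs : IsBackAndForth χ c σ) (b : Γ) :
    ∃ σ', σ ≤ σ' ∧ IsBackAndForth χ c σ' ∧ ∃ b', (b, b') ∈ σ' := by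
  obtain ⟨σ', hle, hσ', hdist⟩ := hs.exists_extension_distances h hsat b
  by_cases hb : ∃ b', (b, b') ∈ σ'
  · exact ⟨σ', hle, hσ', hb⟩
  obtain ⟨t, hle', ht, hbt⟩ := hσ'.exists_extension_of_distances h hsat
    (by rintro p hp rfl; exact hb ⟨p.2, hp⟩) hdist
  exact ⟨t, hle.trans hle', ht, hbt⟩

end IsBackAndForth

end Extension

/-! ### Rational scalars on divisible ordered groups -/

section RatModule

variable {Γ : Type u} [AddCommGroup Γ]

/-- The rational vector space structure of a divisible torsion-free abelian group. -/
@[reducible] noncomputable def ratModuleOfDivisible [IsAddTorsionFree Γ]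
    (hdiv : ∀ n : ℕ, 0 < n → ∀ a : Γ, ∃ b : Γ, n • b = a) : Module ℚ Γ :=
  AddEquiv.module ℚ <| AddEquiv.ofBijective (DivisibleHull.coeAddMonoidHom Γ)
    ⟨DivisibleHull.coe_injective, fun x => by
      induction x with
      | mk num den =>
        obtain ⟨b, hb⟩ := hdiv den den.pos num
        refine ⟨b, ?_⟩
        change DivisibleHull.mk b 1 = DivisibleHull.mk num den
        rw [DivisibleHull.mk_eq_mk_iff_smul_eq_smul]
        simpa using hb⟩

/-- Multiplication by the denominator turns `q • (b - a)` into a positive natural multiple of `b -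
a`, hence something positive. -/
theorem posSMulStrictMono_rat [LinearOrder Γ] [IsOrderedAddMonoid Γ] [Module ℚ Γ] :
    PosSMulStrictMono ℚ Γ := by
  refine ⟨fun q hq a b hab => ?_⟩
  have hsub : 0 < b - a := sub_pos.2 hab
  rw [← sub_pos, ← smul_sub]
  have h1 : q.den • (q • (b - a)) = q.num.toNat • (b - a) := by
    rw [← Nat.cast_smul_eq_nsmul ℚ, ← Nat.cast_smul_eq_nsmul ℚ, smul_smul]
    congr 1
    have : ((q.num.toNat : ℤ) : ℚ) = q.num := by
      rw [Int.toNat_of_nonneg (Rat.num_pos.2 hq).le]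
    rw [Int.cast_natCast] at this
    rw [this, mul_comm, Rat.mul_den_eq_num]
  have h2 : 0 < q.num.toNat • (b - a) := nsmul_pos hsub (by have := Rat.num_pos.2 hq; omega)
  rw [← h1] at h2
  by_contra hn
  exact absurd h2 (nsmul_nonpos (not_lt.1 hn) _).not_gt

end RatModule

/-! ### The ultrapower: a model of T_pdg with the required saturation -/

section Ultrapower

open Filter

/-- The ultrapower of `Γ` along a nonprincipal ultrafilter on `ℕ`. -/
abbrev Ultrapow (Γ : Type u) : Type u := (hyperfilter ℕ : Filter ℕ).Germ Γ

theorem Ultrapow.exists_rep {Γ : Type u} (a : Ultrapow Γ) : ∃ u : ℕ → Γ, (u : Ultrapow Γ) = a :=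
  Quotient.exists_rep a

/-- Ultrapowers realize countable families of internal conditions. -/
theorem Ultrapow.exists_forall_of_finite {Γ : Type u} [Nonempty Γ] {ι : Type*} [Countable ι]
    (P : ι → Ultrapow Γ → Prop) (Q : ι → ℕ → Γ → Prop)
    (hPQ : ∀ k (u : ℕ → Γ), P k u ↔ ∀ᶠ i in (hyperfilter ℕ : Filter ℕ), Q k i (u i))
    (hfin : ∀ F : Finset ι, ∃ x, ∀ k ∈ F, P k x) : ∃ x, ∀ k, P k x := by
  classical
  obtain ⟨f, hf⟩ := exists_injective_nat ι
  let R : ℕ → ℕ → Prop := fun n i => ∃ x : Γ, ∀ k, f k ≤ n → Q k i x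
  have hR : ∀ n, ∀ᶠ i in (hyperfilter ℕ : Filter ℕ), R n i := by
    intro n
    have hfinite : {k | f k ≤ n}.Finite := (Set.finite_Iic n).preimage hf.injOn
    obtain ⟨x, hx⟩ := hfin hfinite.toFinset
    obtain ⟨u, rfl⟩ := x.exists_rep
    have : ∀ᶠ i in (hyperfilter ℕ : Filter ℕ), ∀ k ∈ hfinite.toFinset, Q k i (u i) :=
      (eventually_all_finset _).2 fun k hk => (hPQ k u).1 (hx k hk)
    filter_upwards [this] with i hi
    exact ⟨u i, fun k hk => hi k (by simpa using hk)⟩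
  -- At coordinate `i`, as many conditions as possible are solved together, with index bounded by
  -- `i`. Each condition is eventually included, since the ultrafilter is nonprincipal.
  let N : ℕ → ℕ := fun i => Nat.findGreatest (fun n => R n i) i
  have hx : ∀ i, ∃ x : Γ, R (N i) i → ∀ k, f k ≤ N i → Q k i x := by
    intro i
    by_cases h : R (N i) i
    · exact ⟨h.choose, fun _ => h.choose_spec⟩
    · exact ⟨Classical.arbitrary Γ, fun h' => absurd h' h⟩
  choose x hx using hx
  refine ⟨(x : Ultrapow Γ), fun k => (hPQ k x).2 ?_⟩
  filter_upwards [hR (f k), Nat.hyperfilter_le_atTop (eventually_ge_atTop (f k))] with i h1 h2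
  exact hx i (Nat.findGreatest_spec (P := fun n => R n i) h2 h1) k
    (Nat.le_findGreatest (P := fun n => R n i) h2 h1)

variable {Γ : Type u} [AddCommGroup Γ] [LinearOrder Γ] [IsOrderedAddMonoid Γ]
  {χ : Γ → Γ} {c : Γ}

/-- The coordinatewise extension of `χ` to the ultrapower. -/
noncomputable def Ultrapow.chi (χ : Γ → Γ) : Ultrapow Γ → Ultrapow Γ := Germ.map χ

namespace Ultrapow

theorem coe_lt_zero {u : ℕ → Γ} :
    (u : Ultrapow Γ) < 0 ↔ ∀ᶠ i in (hyperfilter ℕ : Filter ℕ), u i < 0 :=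
  Germ.coe_lt (f := u) (g := fun _ => 0)

theorem coe_pos {u : ℕ → Γ} :
    0 < (u : Ultrapow Γ) ↔ ∀ᶠ i in (hyperfilter ℕ : Filter ℕ), 0 < u i :=
  Germ.coe_lt (f := fun _ => 0) (g := u)

theorem coe_eq_zero {u : ℕ → Γ} :
    (u : Ultrapow Γ) = 0 ↔ ∀ᶠ i in (hyperfilter ℕ : Filter ℕ), u i = 0 :=
  Germ.coe_eq (f := u) (g := fun _ => 0)

theorem chi_coe (χ : Γ → Γ) (u : ℕ → Γ) :
    chi χ (u : Ultrapow Γ) = ((fun i => χ (u i) : ℕ → Γ) : Ultrapow Γ) := rfl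

theorem abs_coe (u : ℕ → Γ) : |(u : Ultrapow Γ)| = ((fun i => |u i| : ℕ → Γ) : Ultrapow Γ) := by
  rw [Germ.abs_def]; rfl

theorem coe_mem_chiNeg {u : ℕ → Γ} :
    (u : Ultrapow Γ) ∈ chiNeg (chi χ) ↔
      ∀ᶠ i in (hyperfilter ℕ : Filter ℕ), u i ∈ chiNeg χ := by
  constructor
  · rintro ⟨y, hy, hyu⟩
    obtain ⟨v, rfl⟩ := y.exists_rep
    filter_upwards [coe_lt_zero.1 hy, Germ.coe_eq.1 hyu] with i h1 h2
    exact ⟨v i, h1, h2⟩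
  · intro hu
    classical
    obtain ⟨v, hv⟩ : ∃ v : ℕ → Γ, ∀ i, u i ∈ chiNeg χ → v i < 0 ∧ χ (v i) = u i := by
      refine ⟨fun i => if h : u i ∈ chiNeg χ then h.choose else 0, fun i hi => ?_⟩
      have hspec := hi.choose_spec
      simp only [dif_pos hi]
      exact hspec
    refine ⟨(v : Ultrapow Γ), coe_lt_zero.2 ?_, Germ.coe_eq.2 ?_⟩
    · filter_upwards [hu] with i hi using (hv i hi).1
    · filter_upwards [hu] with i hi using (hv i hi).2

theorem isPrecontraction_chi (h : IsPrecontraction χ) : IsPrecontraction (chi χ) where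
  map_eq_zero_iff a := by
    obtain ⟨u, rfl⟩ := a.exists_rep
    rw [chi_coe, coe_eq_zero, coe_eq_zero]
    simp only [h.map_eq_zero_iff]
  monotone a b hab := by
    obtain ⟨u, rfl⟩ := a.exists_rep
    obtain ⟨v, rfl⟩ := b.exists_rep
    have h' := Germ.coe_le.1 hab
    rw [chi_coe, chi_coe]
    refine Germ.coe_le.2 ?_
    filter_upwards [h'] with i hi using h.monotone _ _ hi
  map_neg a := by
    obtain ⟨u, rfl⟩ := a.exists_rep
    rw [← Germ.coe_neg, chi_coe, chi_coe, ← Germ.coe_neg]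
    exact Germ.coe_eq.2 (Eventually.of_forall fun i => h.map_neg _)
  map_eq_of_archimedean_equiv a b hmk hsign := by
    obtain ⟨u, rfl⟩ := a.exists_rep
    obtain ⟨v, rfl⟩ := b.exists_rep
    -- Archimedean equivalence is not first-order, but here its witnesses `m` and `n` are standard,
    -- so it descends to almost all coordinates.
    obtain ⟨⟨m, hm⟩, n, hn⟩ := ArchimedeanClass.mk_eq_mk.1 hmk
    rw [abs_coe, abs_coe] at hm hn
    have hm' : ∀ᶠ i in (hyperfilter ℕ : Filter ℕ), |v i| ≤ m • |u i| := Germ.coe_le.1 hm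
    have hn' : ∀ᶠ i in (hyperfilter ℕ : Filter ℕ), |u i| ≤ n • |v i| := Germ.coe_le.1 hn
    have hs : ∀ᶠ i in (hyperfilter ℕ : Filter ℕ), SignType.sign (u i) = SignType.sign (v i) := by
      rcases lt_trichotomy (u : Ultrapow Γ) 0 with ha | ha | ha
      · rw [sign_neg ha, eq_comm, sign_eq_neg_one_iff] at hsign
        filter_upwards [coe_lt_zero.1 ha, coe_lt_zero.1 hsign] with i h1 h2
        rw [sign_neg h1, sign_neg h2]
      · rw [ha, sign_zero, eq_comm, sign_eq_zero_iff] at hsign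
        filter_upwards [coe_eq_zero.1 ha, coe_eq_zero.1 hsign] with i h1 h2
        rw [h1, h2]
      · rw [sign_pos ha, eq_comm, sign_eq_one_iff] at hsign
        filter_upwards [coe_pos.1 ha, coe_pos.1 hsign] with i h1 h2
        rw [sign_pos h1, sign_pos h2]
    rw [chi_coe, chi_coe]
    refine Germ.coe_eq.2 ?_
    filter_upwards [hm', hn', hs] with i h1 h2 h3
    exact h.map_eq_of_archimedean_equiv _ _ (ArchimedeanClass.mk_eq_mk.2 ⟨⟨m, h1⟩, n, h2⟩) h3

theorem isModelTpdg_chi (h : IsModelTpdg χ c) :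
    IsModelTpdg (chi χ) ((fun _ => c : ℕ → Γ) : Ultrapow Γ) where
  nontrivial := by
    have := h.nontrivial
    infer_instance
  precontraction := isPrecontraction_chi h.precontraction
  centripetal a ha := by
    obtain ⟨u, rfl⟩ := a.exists_rep
    rw [Ne, coe_eq_zero, ← Ultrafilter.eventually_not] at ha
    rw [chi_coe, abs_coe, abs_coe]
    refine Germ.coe_lt.2 ?_
    filter_upwards [ha] with i hi using h.centripetal _ hi
  isLeast := by
    refine ⟨coe_mem_chiNeg.2 (Eventually.of_forall fun _ => h.c_mem), fun a ha => ?_⟩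
    obtain ⟨u, rfl⟩ := a.exists_rep
    refine Germ.coe_le.2 ?_
    filter_upwards [coe_mem_chiNeg.1 ha] with i hi using h.c_le hi
  bijOn := by
    refine ⟨fun a ha => ?_, fun a ha b hb hab => ?_, fun a ha => ?_⟩
    · obtain ⟨u, rfl⟩ := a.exists_rep
      have hu := coe_mem_chiNeg.1 ha
      refine ⟨coe_mem_chiNeg.2 ?_, Germ.coe_lt.2 ?_⟩
      · filter_upwards [hu] with i hi using h.chi_mem hi
      · filter_upwards [hu] with i hi using h.c_lt_chi hi
    · obtain ⟨u, rfl⟩ := a.exists_rep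
      obtain ⟨v, rfl⟩ := b.exists_rep
      refine Germ.coe_eq.2 ?_
      filter_upwards [coe_mem_chiNeg.1 ha, coe_mem_chiNeg.1 hb, Germ.coe_eq.1 hab] with i h1 h2 h3
      exact h.chi_inj h1 h2 h3
    · obtain ⟨u, rfl⟩ := a.exists_rep
      have hu := coe_mem_chiNeg.1 ha.1
      have hcu := Germ.coe_lt.1 ha.2
      have hex : ∀ i, ∃ e, u i ∈ chiNeg χ ∧ c < u i → e ∈ chiNeg χ ∧ χ e = u i := fun i => by
        by_cases hi : u i ∈ chiNeg χ ∧ c < u i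
        · obtain ⟨e, he⟩ := h.exists_pred hi.1 hi.2
          exact ⟨e, fun _ => he⟩
        · exact ⟨0, fun h' => absurd h' hi⟩
      choose e he using hex
      refine ⟨(e : Ultrapow Γ), coe_mem_chiNeg.2 ?_, Germ.coe_eq.2 ?_⟩
      · filter_upwards [hu, hcu] with i h1 h2 using (he i ⟨h1, h2⟩).1
      · filter_upwards [hu, hcu] with i h1 h2 using (he i ⟨h1, h2⟩).2
  succ a ha b hb hab := by
    obtain ⟨u, rfl⟩ := a.exists_rep
    obtain ⟨v, rfl⟩ := b.exists_rep
    rw [chi_coe]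
    refine ⟨Germ.coe_lt.2 ?_, Germ.coe_le.2 ?_⟩ <;>
      filter_upwards [coe_mem_chiNeg.1 ha, coe_mem_chiNeg.1 hb, Germ.coe_lt.1 hab] with i h1 h2 h3
    · exact (h.succ _ h1 _ h2 h3).1
    · exact (h.succ _ h1 _ h2 h3).2
  divisible n hn a := by
    obtain ⟨u, rfl⟩ := a.exists_rep
    choose v hv using h.divisible n hn
    refine ⟨((fun i => v (u i) : ℕ → Γ) : Ultrapow Γ), Germ.coe_eq.2 ?_⟩
    exact Eventually.of_forall fun i => hv (u i)

theorem isCountablySaturated_chi (χ : Γ → Γ) : IsCountablySaturated (chi χ) := by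
  classical
  choose rep hrep using exists_rep (Γ := Γ)
  have hlt : ∀ (a : Ultrapow Γ) (u : ℕ → Γ),
      a < u ↔ ∀ᶠ i in (hyperfilter ℕ : Filter ℕ), rep a i < u i := fun a u => by
    conv_lhs => rw [← hrep a]
    exact Germ.coe_lt
  have hgt : ∀ (a : Ultrapow Γ) (u : ℕ → Γ),
      u < a ↔ ∀ᶠ i in (hyperfilter ℕ : Filter ℕ), u i < rep a i := fun a u => by
    conv_lhs => rw [← hrep a]
    exact Germ.coe_lt
  have hsub : ∀ (a b : Ultrapow Γ) (u : ℕ → Γ), chi χ (u - a) = b ↔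
      ∀ᶠ i in (hyperfilter ℕ : Filter ℕ), χ (u i - rep a i) = rep b i := fun a b u => by
    conv_lhs => rw [← hrep a, ← hrep b]
    exact Germ.coe_eq
  have hbus : ∀ (a b : Ultrapow Γ) (u : ℕ → Γ), chi χ (a - u) = b ↔
      ∀ᶠ i in (hyperfilter ℕ : Filter ℕ), χ (rep a i - u i) = rep b i := fun a b u => by
    conv_lhs => rw [← hrep a, ← hrep b]
    exact Germ.coe_eq
  constructor
  · intro A B hA hB hfin
    have := hA.to_subtype
    have := hB.to_subtype
    -- The index `none` carries the condition of lying in Δ.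
    obtain ⟨x, hx⟩ := exists_forall_of_finite (ι := Option (A ⊕ B))
      (fun k x => match k with
        | none => x ∈ chiNeg (chi χ)
        | some (Sum.inl a) => a.1 < x
        | some (Sum.inr b) => x < b.1)
      (fun k i x => match k with
        | none => x ∈ chiNeg χ
        | some (Sum.inl a) => rep a.1 i < x
        | some (Sum.inr b) => x < rep b.1 i)
      (by
        rintro (_ | a | b) u
        exacts [coe_mem_chiNeg, hlt _ _, hgt _ _])
      (by
        intro F
        obtain ⟨d, hd, hdA, hdB⟩ := hfin
          (F.biUnion fun k => match k with
            | some (Sum.inl a) => {a.1}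
            | _ => ∅)
          (F.biUnion fun k => match k with
            | some (Sum.inr a) => {a.1}
            | _ => ∅)
          (by
            intro y hy
            simp only [Finset.coe_biUnion, Set.mem_iUnion] at hy
            obtain ⟨_ | a | b, -, hy⟩ := hy <;> simp at hy
            exact hy ▸ a.2)
          (by
            intro y hy
            simp only [Finset.coe_biUnion, Set.mem_iUnion] at hy
            obtain ⟨_ | a | b, -, hy⟩ := hy <;> simp at hy
            exact hy ▸ b.2)
        refine ⟨d, ?_⟩
        rintro (_ | a | b) hk
        · exact hd
        · exact hdA _ (Finset.mem_biUnion.2 ⟨_, hk, by simp⟩)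
        · exact hdB _ (Finset.mem_biUnion.2 ⟨_, hk, by simp⟩))
    exact ⟨x, hx none, fun a ha => hx (some (Sum.inl ⟨a, ha⟩)),
      fun b hb => hx (some (Sum.inr ⟨b, hb⟩))⟩
  · intro A B hA hB hfin
    have := hA.to_subtype
    have := hB.to_subtype
    obtain ⟨x, hx⟩ := exists_forall_of_finite (ι := A ⊕ B)
      (fun k x => match k with
        | Sum.inl a => a.1.1 < x ∧ chi χ (x - a.1.1) = a.1.2
        | Sum.inr b => x < b.1.1 ∧ chi χ (b.1.1 - x) = b.1.2)
      (fun k i x => match k with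
        | Sum.inl a => rep a.1.1 i < x ∧ χ (x - rep a.1.1 i) = rep a.1.2 i
        | Sum.inr b => x < rep b.1.1 i ∧ χ (rep b.1.1 i - x) = rep b.1.2 i)
      (by
        rintro (a | b) u
        · simp only [eventually_and, hlt, hsub]
        · simp only [eventually_and, hgt, hbus])
      (by
        intro F
        obtain ⟨d, hdA, hdB⟩ := hfin
          (F.biUnion fun k => match k with
            | Sum.inl a => {a.1}
            | _ => ∅)
          (F.biUnion fun k => match k with
            | Sum.inr a => {a.1}
            | _ => ∅)
          (by
            intro y hy
            simp only [Finset.coe_biUnion, Set.mem_iUnion] at hy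
            obtain ⟨a | b, -, hy⟩ := hy <;> simp at hy
            exact hy ▸ a.2)
          (by
            intro y hy
            simp only [Finset.coe_biUnion, Set.mem_iUnion] at hy
            obtain ⟨a | b, -, hy⟩ := hy <;> simp at hy
            exact hy ▸ b.2)
        refine ⟨d, ?_⟩
        rintro (a | b) hk
        · exact hdA _ (Finset.mem_biUnion.2 ⟨_, hk, by simp⟩)
        · exact hdB _ (Finset.mem_biUnion.2 ⟨_, hk, by simp⟩))
    exact ⟨x, fun a ha => hx (Sum.inl ⟨a, ha⟩), fun b hb => hx (Sum.inr ⟨b, hb⟩)⟩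

end Ultrapow

end Ultrapower

/-! ### The symbol χ⁻¹ and the point ∞ -/

section ChiInv

variable {Γ : Type u} [AddCommGroup Γ] [LinearOrder Γ] [IsOrderedAddMonoid Γ]
  {χ : Γ → Γ} {c : Γ}

theorem chiInvFun_chi (h : IsModelTpdg χ c) {b : Γ} (hb : b ∈ chiNeg χ) :
    chiInvFun χ (χ b : Γ) = (b : WithTop Γ) := by
  have hχ := h.neg_of_mem (h.chi_mem hb)
  have hmem : χ b ∈ χ '' chiNeg χ := ⟨b, hb, rfl⟩
  simp only [chiInvFun, if_neg hχ.ne, if_pos hmem]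
  rw [h.bijOn.injOn (Function.invFunOn_mem hmem) hb (Function.invFunOn_eq hmem)]

/-- A description free of choice functions, which can be transferred to germs clause by clause. -/
theorem chiInvFun_eq_coe_iff (h : IsModelTpdg χ c) {a b : Γ} :
    chiInvFun χ (a : WithTop Γ) = (b : WithTop Γ) ↔
      (a = 0 ∧ b = 0) ∨ (b ∈ chiNeg χ ∧ χ b = a) ∨ (-b ∈ chiNeg χ ∧ χ b = a) := by
  have hpr := h.precontraction
  constructor
  · intro hab
    simp only [chiInvFun] at hab
    split_ifs at hab with h1 h2 h3
    · exact Or.inl ⟨h1, (WithTop.coe_injective hab).symm⟩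
    · rw [← WithTop.coe_injective hab]
      exact Or.inr (Or.inl ⟨Function.invFunOn_mem h2, Function.invFunOn_eq h2⟩)
    · rw [← WithTop.coe_injective hab]
      refine Or.inr (Or.inr ⟨by rw [neg_neg]; exact Function.invFunOn_mem h3, ?_⟩)
      rw [hpr.map_neg, Function.invFunOn_eq h3, neg_neg]
    · exact absurd hab.symm WithTop.coe_ne_top
  · rintro (⟨rfl, rfl⟩ | ⟨hb, rfl⟩ | ⟨hb, hba⟩)
    · simp [chiInvFun]
    · exact chiInvFun_chi h hb
    · have hχ := h.neg_of_mem (h.chi_mem hb)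
      rw [hpr.map_neg, hba] at hχ
      have hmem : -a ∈ χ '' chiNeg χ := ⟨-b, hb, by rw [hpr.map_neg, hba]⟩
      have hn : a ∉ χ '' chiNeg χ := by
        rintro ⟨e, he, hea⟩
        have := h.neg_of_mem (h.chi_mem he)
        rw [hea] at this
        exact absurd (neg_lt_zero.1 hχ) this.not_gt
      have h0 : a ≠ 0 := (neg_lt_zero.1 hχ).ne'
      simp only [chiInvFun, if_neg h0, if_neg hn, if_pos hmem]
      rw [h.bijOn.injOn (Function.invFunOn_mem hmem) hb
        (by rw [Function.invFunOn_eq hmem, hpr.map_neg, hba]), neg_neg]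

theorem nsmul_divFun (h : IsModelTpdg χ c) (n : ℕ+) (a : Γ) : (n : ℕ) • divFun (n : ℕ) a = a :=
  Function.invFun_eq (f := fun b : Γ => (n : ℕ) • b) (h.divisible n n.pos a)

/-- The element `∞` of `Γ_∞`. -/
def GammaInf.top (χ : Γ → Γ) (c : Γ) : GammaInf χ c := (⊤ : WithTop Γ)

theorem GammaInf.of_injective : Function.Injective (GammaInf.of χ c) := WithTop.coe_injective

theorem GammaInf.of_ne_top (a : Γ) : GammaInf.of χ c a ≠ GammaInf.top χ c := WithTop.coe_ne_top

theorem GammaInf.of_lt_of {a b : Γ} : GammaInf.of χ c a < GammaInf.of χ c b ↔ a < b :=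
  WithTop.coe_lt_coe

theorem GammaInf.of_lt_top (a : Γ) : GammaInf.of χ c a < GammaInf.top χ c := WithTop.coe_lt_top a

theorem GammaInf.not_top_lt (a : GammaInf χ c) : ¬ GammaInf.top χ c < a :=
  fun h => _root_.not_top_lt (α := WithTop Γ) h

theorem GammaInf.eq_top_or (a : GammaInf χ c) : a = GammaInf.top χ c ∨ ∃ b, a = GammaInf.of χ c b := by
  induction a using WithTop.recTopCoe with
  | top => exact Or.inl rfl
  | coe b => exact Or.inr ⟨b, rfl⟩

end ChiInv

/-! ### From back-and-forth to equality of truth values -/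

section Transfer

open Filter Language

variable {Γ : Type u} [AddCommGroup Γ] [LinearOrder Γ] [IsOrderedAddMonoid Γ]
  {χ : Γ → Γ} {c : Γ} [Module ℚ (Ultrapow Γ)]

/-- The constant germ `c`. -/
noncomputable def Ultrapow.const (c : Γ) : Ultrapow Γ := ((fun _ => c : ℕ → Γ) : Ultrapow Γ)

/-- Two sequences in `Γ_∞` represent elements matched by `σ`, or both represent `∞`. -/
def Matched (σ : Submodule ℚ (Ultrapow Γ × Ultrapow Γ)) (x y : ℕ → GammaInf χ c) : Prop :=
  ((∀ᶠ i in (hyperfilter ℕ : Filter ℕ), x i = GammaInf.top χ c) ∧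
    ∀ᶠ i in (hyperfilter ℕ : Filter ℕ), y i = GammaInf.top χ c) ∨
  ∃ u v : ℕ → Γ, (∀ᶠ i in (hyperfilter ℕ : Filter ℕ), x i = GammaInf.of χ c (u i)) ∧
    (∀ᶠ i in (hyperfilter ℕ : Filter ℕ), y i = GammaInf.of χ c (v i)) ∧
    ((u : Ultrapow Γ), (v : Ultrapow Γ)) ∈ σ

theorem IsBackAndForth.exists_pred {V : Type u} [AddCommGroup V] [LinearOrder V]
    [IsOrderedAddMonoid V] [Module ℚ V] {χ : V → V} {c : V} {σ : Submodule ℚ (V × V)}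
    (h : IsModelTpdg χ c) (hs : IsBackAndForth χ c σ) {d y : V} (hd : d ∈ chiNeg χ)
    (hm : (χ d, y) ∈ σ) : ∃ e ∈ chiNeg χ, χ e = y ∧ (d, e) ∈ σ := by
  have hy := hs.snd_mem h hm (h.chi_mem hd)
  obtain ⟨e, he, rfl⟩ := h.exists_pred hy ((hs.lt_iff hs.c_mem hm).1 (h.c_lt_chi hd))
  exact ⟨e, he, rfl, hs.pred_mem d hd e he hm⟩

namespace Matched

variable {σ : Submodule ℚ (Ultrapow Γ × Ultrapow Γ)} {x y x' y' : ℕ → GammaInf χ c}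

theorem mono {σ' : Submodule ℚ (Ultrapow Γ × Ultrapow Γ)} (hle : σ ≤ σ') (hx : Matched σ x y) :
    Matched σ' x y := by
  rcases hx with hx | ⟨u, v, h1, h2, h3⟩
  exacts [Or.inl hx, Or.inr ⟨u, v, h1, h2, hle h3⟩]

theorem swap (hx : Matched σ x y) :
    Matched (σ.comap (LinearEquiv.prodComm ℚ (Ultrapow Γ) (Ultrapow Γ)).toLinearMap) y x := by
  rcases hx with hx | ⟨u, v, h1, h2, h3⟩
  exacts [Or.inl hx.symm, Or.inr ⟨v, u, h2, h1, h3⟩]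

theorem eq_of_eq (hs : IsBackAndForth (Ultrapow.chi χ) (Ultrapow.const c) σ)
    (hx : Matched σ x y) (hx' : Matched σ x' y')
    (heq : ∀ᶠ i in (hyperfilter ℕ : Filter ℕ), x i = x' i) :
    ∀ᶠ i in (hyperfilter ℕ : Filter ℕ), y i = y' i := by
  rcases hx with ⟨h1, h2⟩ | ⟨u, v, h1, h2, h3⟩ <;>
    rcases hx' with ⟨h1', h2'⟩ | ⟨u', v', h1', h2', h3'⟩
  · filter_upwards [h2, h2'] with i k1 k2 using k1.trans k2.symm
  · obtain ⟨i, k1, k2, k3⟩ := (h1.and (h1'.and heq)).exists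
    exact absurd (k2.symm.trans (k3.symm.trans k1)) (GammaInf.of_ne_top _)
  · obtain ⟨i, k1, k2, k3⟩ := (h1.and (h1'.and heq)).exists
    exact absurd (k1.symm.trans (k3.trans k2)) (GammaInf.of_ne_top _)
  · have huu : (u : Ultrapow Γ) = u' := by
      refine Germ.coe_eq.2 ?_
      filter_upwards [h1, h1', heq] with i k1 k2 k3
      exact GammaInf.of_injective (k1.symm.trans (k3.trans k2))
    have hvv := Germ.coe_eq.1 ((hs.eq_iff h3 h3').1 huu)
    filter_upwards [h2, h2', hvv] with i k1 k2 k3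
    rw [k1, k2, k3]

theorem lt_of_lt (hs : IsBackAndForth (Ultrapow.chi χ) (Ultrapow.const c) σ)
    (hx : Matched σ x y) (hx' : Matched σ x' y')
    (hlt : ∀ᶠ i in (hyperfilter ℕ : Filter ℕ), x i < x' i) :
    ∀ᶠ i in (hyperfilter ℕ : Filter ℕ), y i < y' i := by
  rcases hx with ⟨h1, h2⟩ | ⟨u, v, h1, h2, h3⟩
  · obtain ⟨i, k1, k2⟩ := (h1.and hlt).exists
    exact absurd (k1 ▸ k2) (GammaInf.not_top_lt _)
  rcases hx' with ⟨h1', h2'⟩ | ⟨u', v', h1', h2', h3'⟩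
  · filter_upwards [h2, h2'] with i k1 k2
    rw [k1, k2]
    exact GammaInf.of_lt_top _
  · have huu : (u : Ultrapow Γ) < u' := by
      refine Germ.coe_lt.2 ?_
      filter_upwards [h1, h1', hlt] with i k1 k2 k3
      rw [k1, k2] at k3
      exact GammaInf.of_lt_of.1 k3
    have hvv := Germ.coe_lt.1 ((hs.lt_iff h3 h3').1 huu)
    filter_upwards [h2, h2', hvv] with i k1 k2 k3
    rw [k1, k2]
    exact GammaInf.of_lt_of.2 k3

theorem map {g : Γ → Γ}
    (hg : ∀ u v : ℕ → Γ, ((u : Ultrapow Γ), (v : Ultrapow Γ)) ∈ σ →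
      (((fun i => g (u i) : ℕ → Γ) : Ultrapow Γ), ((fun i => g (v i) : ℕ → Γ) : Ultrapow Γ)) ∈ σ)
    (hx : Matched σ x y) :
    Matched (χ := χ) (c := c) σ (fun i => WithTop.map g (x i)) (fun i => WithTop.map g (y i)) := by
  rcases hx with ⟨h1, h2⟩ | ⟨u, v, h1, h2, h3⟩
  · left
    constructor
    · filter_upwards [h1] with i k
      rw [k]; rfl
    · filter_upwards [h2] with i k
      rw [k]; rfl
  · refine Or.inr ⟨fun i => g (u i), fun i => g (v i), ?_, ?_, hg u v h3⟩
    · filter_upwards [h1] with i k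
      rw [k]; rfl
    · filter_upwards [h2] with i k
      rw [k]; rfl

theorem add (hx : Matched σ x y) (hx' : Matched σ x' y') :
    Matched (χ := χ) (c := c) σ
      (fun i => HAdd.hAdd (α := WithTop Γ) (β := WithTop Γ) (x i) (x' i))
      (fun i => HAdd.hAdd (α := WithTop Γ) (β := WithTop Γ) (y i) (y' i)) := by
  rcases hx with ⟨h1, h2⟩ | ⟨u, v, h1, h2, h3⟩
  · left
    constructor
    · filter_upwards [h1] with i k
      rw [k]; exact WithTop.top_add _
    · filter_upwards [h2] with i k
      rw [k]; exact WithTop.top_add _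
  rcases hx' with ⟨h1', h2'⟩ | ⟨u', v', h1', h2', h3'⟩
  · left
    constructor
    · filter_upwards [h1'] with i k
      rw [k]; exact WithTop.add_top _
    · filter_upwards [h2'] with i k
      rw [k]; exact WithTop.add_top _
  · refine Or.inr ⟨fun i => u i + u' i, fun i => v i + v' i, ?_, ?_, σ.add_mem h3 h3'⟩
    · filter_upwards [h1, h1'] with i k k'
      rw [k, k']; rfl
    · filter_upwards [h2, h2'] with i k k'
      rw [k, k']; rfl

/-- The ultrafilter selects one of the three clauses of `chiInvFun_eq_coe_iff`, and closure of σ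
under predecessors carries that clause over; the third reduces to the second by negation. -/
theorem exists_chiInv (h : IsModelTpdg χ c)
    (hs : IsBackAndForth (Ultrapow.chi χ) (Ultrapow.const c) σ) {u v : ℕ → Γ}
    (huv : ((u : Ultrapow Γ), (v : Ultrapow Γ)) ∈ σ)
    (hne : ∀ᶠ i in (hyperfilter ℕ : Filter ℕ), chiInvFun χ (u i : WithTop Γ) ≠ ⊤) :
    ∃ u' v' : ℕ → Γ,
      (∀ᶠ i in (hyperfilter ℕ : Filter ℕ), chiInvFun χ (u i : WithTop Γ) = (u' i : WithTop Γ)) ∧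
      (∀ᶠ i in (hyperfilter ℕ : Filter ℕ), chiInvFun χ (v i : WithTop Γ) = (v' i : WithTop Γ)) ∧
      ((u' : Ultrapow Γ), (v' : Ultrapow Γ)) ∈ σ := by
  have hU : IsModelTpdg (Ultrapow.chi χ) (Ultrapow.const c) := Ultrapow.isModelTpdg_chi h
  have hex : ∀ i, ∃ b : Γ, chiInvFun χ (u i : WithTop Γ) ≠ ⊤ →
      chiInvFun χ (u i : WithTop Γ) = (b : WithTop Γ) := fun i => by
    by_cases hi : chiInvFun χ (u i : WithTop Γ) = ⊤
    · exact ⟨0, fun h' => absurd hi h'⟩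
    · obtain ⟨b, hb⟩ := WithTop.ne_top_iff_exists.1 hi
      exact ⟨b, fun _ => hb.symm⟩
  choose u' hu' using hex
  have hu : ∀ᶠ i in (hyperfilter ℕ : Filter ℕ),
      chiInvFun χ (u i : WithTop Γ) = (u' i : WithTop Γ) := by
    filter_upwards [hne] with i hi using hu' i hi
  refine ⟨u', ?_⟩
  suffices ∃ v' : ℕ → Γ,
      (∀ᶠ i in (hyperfilter ℕ : Filter ℕ), chiInvFun χ (v i : WithTop Γ) = (v' i : WithTop Γ)) ∧
      ((u' : Ultrapow Γ), (v' : Ultrapow Γ)) ∈ σ by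
    obtain ⟨v', h1, h2⟩ := this
    exact ⟨v', hu, h1, h2⟩
  simp only [chiInvFun_eq_coe_iff h, Ultrafilter.eventually_or] at hu ⊢
  rcases hu with hu | hu | hu
  · have h0 : (u : Ultrapow Γ) = 0 := Ultrapow.coe_eq_zero.2 (hu.mono fun i hi => hi.1)
    have h0' : (u' : Ultrapow Γ) = 0 := Ultrapow.coe_eq_zero.2 (hu.mono fun i hi => hi.2)
    have hv : (v : Ultrapow Γ) = 0 := (hs.eq_iff huv σ.zero_mem).1 h0
    refine ⟨fun _ => 0, Or.inl ?_, ?_⟩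
    · filter_upwards [Ultrapow.coe_eq_zero.1 hv] with i hi using ⟨hi, rfl⟩
    · rw [h0']; exact σ.zero_mem
  · have hd : (u' : Ultrapow Γ) ∈ chiNeg (Ultrapow.chi χ) :=
      Ultrapow.coe_mem_chiNeg.2 (hu.mono fun i hi => hi.1)
    have hχ : Ultrapow.chi χ u' = u := Germ.coe_eq.2 (hu.mono fun i hi => hi.2)
    obtain ⟨e, he, hev, hm⟩ := hs.exists_pred hU hd (hχ ▸ huv)
    obtain ⟨v', rfl⟩ := e.exists_rep
    refine ⟨v', Or.inr (Or.inl ?_), hm⟩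
    filter_upwards [Ultrapow.coe_mem_chiNeg.1 he, Germ.coe_eq.1 hev] with i k1 k2 using ⟨k1, k2⟩
  · have hd : -(u' : Ultrapow Γ) ∈ chiNeg (Ultrapow.chi χ) :=
      Ultrapow.coe_mem_chiNeg.2 (hu.mono fun i hi => hi.1)
    have hχ : Ultrapow.chi χ u' = u := Germ.coe_eq.2 (hu.mono fun i hi => hi.2)
    obtain ⟨e, he, hev, hm⟩ := hs.exists_pred hU (y := -(v : Ultrapow Γ)) hd (by
      rw [hU.precontraction.map_neg, hχ]
      exact σ.neg_mem huv)
    obtain ⟨v', hv'⟩ := (-e).exists_rep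
    have hev' : -(v' : Ultrapow Γ) = e := by rw [hv', neg_neg]
    have hχv : Ultrapow.chi χ v' = v := by
      rw [hv', hU.precontraction.map_neg, hev, neg_neg]
    refine ⟨v', Or.inr (Or.inr ?_), ?_⟩
    · rw [← hev'] at he
      have he' := Ultrapow.coe_mem_chiNeg (u := fun i => -v' i) |>.1 he
      filter_upwards [he', Germ.coe_eq.1 hχv] with i k1 k2 using ⟨k1, k2⟩
    · rw [← hev'] at hm
      simpa using σ.neg_mem hm

theorem chiInv (h : IsModelTpdg χ c)
    (hs : IsBackAndForth (Ultrapow.chi χ) (Ultrapow.const c) σ) (hx : Matched σ x y) :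
    Matched (χ := χ) (c := c) σ (fun i => chiInvFun χ (x i)) (fun i => chiInvFun χ (y i)) := by
  rcases hx with ⟨h1, h2⟩ | ⟨u, v, h1, h2, h3⟩
  · left
    constructor
    · filter_upwards [h1] with i k
      rw [k]; rfl
    · filter_upwards [h2] with i k
      rw [k]; rfl
  by_cases hu : ∀ᶠ i in (hyperfilter ℕ : Filter ℕ), chiInvFun χ (u i : WithTop Γ) ≠ ⊤
  · obtain ⟨u', v', k1, k2, k3⟩ := exists_chiInv h hs h3 hu
    refine Or.inr ⟨u', v', ?_, ?_, k3⟩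
    · filter_upwards [h1, k1] with i l1 l2
      rw [l1]; exact l2
    · filter_upwards [h2, k2] with i l1 l2
      rw [l1]; exact l2
  -- A finite value on the right would force one on the left, by the same lemma for the inverse of
  -- σ.
  by_cases hv : ∀ᶠ i in (hyperfilter ℕ : Filter ℕ), chiInvFun χ (v i : WithTop Γ) ≠ ⊤
  · obtain ⟨v', u', k1, k2, k3⟩ := exists_chiInv h hs.swap (u := v) (v := u) h3 hv
    refine Or.inr ⟨u', v', ?_, ?_, k3⟩
    · filter_upwards [h1, k2] with i l1 l2
      rw [l1]; exact l2
    · filter_upwards [h2, k1] with i l1 l2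
      rw [l1]; exact l2
  · simp only [Ne, Ultrafilter.eventually_not, not_not] at hu hv
    left
    constructor
    · filter_upwards [h1, hu] with i l1 l2
      rw [l1]; exact l2
    · filter_upwards [h2, hv] with i l1 l2
      rw [l1]; exact l2

theorem const_mem {a : Γ} (ha : (Ultrapow.const a, Ultrapow.const a) ∈ σ) :
    Matched (χ := χ) (c := c) σ (fun _ => GammaInf.of χ c a) (fun _ => GammaInf.of χ c a) :=
  Or.inr ⟨fun _ => a, fun _ => a, Eventually.of_forall fun _ => rfl,
    Eventually.of_forall fun _ => rfl, ha⟩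

theorem funMap (h : IsModelTpdg χ c)
    (hs : IsBackAndForth (Ultrapow.chi χ) (Ultrapow.const c) σ) {n : ℕ}
    (f : LpdgStar.Functions n) {xs ys : Fin n → ℕ → GammaInf χ c}
    (hxs : ∀ j, Matched σ (xs j) (ys j)) :
    Matched σ (fun i => Structure.funMap f (fun j => xs j i))
      (fun i => Structure.funMap f (fun j => ys j i)) := by
  cases f with
  | zero => exact const_mem (a := 0) σ.zero_mem
  | c => exact const_mem (a := c) hs.c_mem
  | infty => exact Or.inl ⟨Eventually.of_forall fun _ => rfl, Eventually.of_forall fun _ => rfl⟩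
  | neg => exact (hxs 0).map fun u v huv => σ.neg_mem huv
  | chi => exact (hxs 0).map fun u v huv => hs.chi_mem _ huv
  | chiInv => exact (hxs 0).chiInv h hs
  | delta n =>
    refine (hxs 0).map fun u v huv => ?_
    have hn : ((n : ℕ) : ℚ) ≠ 0 := by exact_mod_cast n.ne_zero
    -- Coordinatewise division by `n` is the scalar 1/`n`, which a ℚ-subspace respects.
    have key : ∀ u : ℕ → Γ, ((n : ℕ) : ℚ)⁻¹ • (u : Ultrapow Γ) =
        ((fun i => divFun (n : ℕ) (u i) : ℕ → Γ) : Ultrapow Γ) := fun u => by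
      rw [inv_smul_eq_iff₀ hn, Nat.cast_smul_eq_nsmul]
      exact Germ.coe_eq.2 (Eventually.of_forall fun i => (nsmul_divFun h n (u i)).symm)
    rw [← key, ← key]
    exact σ.smul_mem _ huv
  | add => exact (hxs 0).add (hxs 1)

theorem realize_term (h : IsModelTpdg χ c)
    (hs : IsBackAndForth (Ultrapow.chi χ) (Ultrapow.const c) σ) {α : Type*}
    (t : LpdgStar.Term α) {v w : α → ℕ → GammaInf χ c} (hvw : ∀ j, Matched σ (v j) (w j)) :
    Matched σ (fun i => t.realize (fun j => v j i)) (fun i => t.realize (fun j => w j i)) := by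
  induction t with
  | var j => exact hvw j
  | func f ts ih => exact funMap h hs f ih

theorem exists_forth [PosSMulStrictMono ℚ (Ultrapow Γ)] (h : IsModelTpdg χ c)
    (hs : IsBackAndForth (Ultrapow.chi χ) (Ultrapow.const c) σ) (z : ℕ → GammaInf χ c) :
    ∃ σ', σ ≤ σ' ∧ IsBackAndForth (Ultrapow.chi χ) (Ultrapow.const c) σ' ∧
      ∃ z', Matched σ' z z' := by
  by_cases hz : ∀ᶠ i in (hyperfilter ℕ : Filter ℕ), z i = GammaInf.top χ c
  · exact ⟨σ, le_rfl, hs, z, Or.inl ⟨hz, hz⟩⟩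
  · rw [← Ultrafilter.eventually_not] at hz
    have hex : ∀ i, ∃ b : Γ, z i ≠ GammaInf.top χ c → z i = GammaInf.of χ c b := fun i => by
      rcases (z i).eq_top_or with hi | ⟨b, hb⟩
      · exact ⟨0, fun h' => absurd hi h'⟩
      · exact ⟨b, fun _ => hb⟩
    choose u hu using hex
    obtain ⟨σ', hle, hσ', b', hb'⟩ := hs.exists_forth (Ultrapow.isModelTpdg_chi h)
      (Ultrapow.isCountablySaturated_chi χ) (u : Ultrapow Γ)
    obtain ⟨v, rfl⟩ := b'.exists_rep
    exact ⟨σ', hle, hσ', fun i => GammaInf.of χ c (v i), Or.inr ⟨u, v,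
      hz.mono fun i hi => hu i hi, Eventually.of_forall fun _ => rfl, hb'⟩⟩

/-- Matched tuples of sequences satisfy the same formulas almost everywhere. -/
theorem realize_iff [PosSMulStrictMono ℚ (Ultrapow Γ)] (h : IsModelTpdg χ c) {α : Type*} {n : ℕ}
    (φ : LpdgStar.BoundedFormula α n) :
    ∀ {σ : Submodule ℚ (Ultrapow Γ × Ultrapow Γ)}
      (_ : IsBackAndForth (Ultrapow.chi χ) (Ultrapow.const c) σ)
      {v w : α → ℕ → GammaInf χ c} {xs ys : Fin n → ℕ → GammaInf χ c}
      (_ : ∀ j, Matched σ (v j) (w j)) (_ : ∀ j, Matched σ (xs j) (ys j)),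
      (∀ᶠ i in (hyperfilter ℕ : Filter ℕ), φ.Realize (fun j => v j i) (fun j => xs j i)) ↔
      ∀ᶠ i in (hyperfilter ℕ : Filter ℕ), φ.Realize (fun j => w j i) (fun j => ys j i) := by
  have sumElim : ∀ {n : ℕ} (v : α → ℕ → GammaInf χ c) (xs : Fin n → ℕ → GammaInf χ c) (i : ℕ),
      Sum.elim (fun j => v j i) (fun j => xs j i) = fun j => Sum.elim v xs j i := by
    intro n v xs i
    funext j
    cases j <;> rfl
  induction φ with
  | falsum => intros; rfl
  | equal t₁ t₂ =>
    intro σ hs v w xs ys hvw hxy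
    simp only [BoundedFormula.Realize, sumElim]
    have hm : ∀ j, Matched σ (Sum.elim v xs j) (Sum.elim w ys j) := Sum.rec hvw hxy
    have m1 := realize_term h hs t₁ hm
    have m2 := realize_term h hs t₂ hm
    exact ⟨m1.eq_of_eq hs m2, m1.swap.eq_of_eq hs.swap m2.swap⟩
  | rel R ts =>
    intro σ hs v w xs ys hvw hxy
    cases R
    simp only [BoundedFormula.Realize, sumElim]
    have hm : ∀ j, Matched σ (Sum.elim v xs j) (Sum.elim w ys j) := Sum.rec hvw hxy
    have m1 := realize_term h hs (ts 0) hm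
    have m2 := realize_term h hs (ts 1) hm
    exact ⟨m1.lt_of_lt hs m2, m1.swap.lt_of_lt hs.swap m2.swap⟩
  | imp φ ψ ihφ ihψ =>
    intro σ hs v w xs ys hvw hxy
    simp only [BoundedFormula.Realize, Ultrafilter.eventually_imp]
    rw [ihφ hs hvw hxy, ihψ hs hvw hxy]
  | all φ ih =>
    rename_i n
    have snoc : ∀ (xs : Fin n → ℕ → GammaInf χ c) (z : ℕ → GammaInf χ c) (i : ℕ),
        (Fin.snoc (fun j => xs j i) (z i) : Fin (n + 1) → GammaInf χ c) =
          fun j => (Fin.snoc xs z : Fin (n + 1) → ℕ → GammaInf χ c) j i := by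
      intro xs z i
      funext j
      refine Fin.lastCases ?_ (fun j => ?_) j <;> simp
    -- One implication suffices, since the system is closed under inverses.
    have one : ∀ {σ : Submodule ℚ (Ultrapow Γ × Ultrapow Γ)}
        (_ : IsBackAndForth (Ultrapow.chi χ) (Ultrapow.const c) σ)
        {v w : α → ℕ → GammaInf χ c} {xs ys : Fin n → ℕ → GammaInf χ c}
        (_ : ∀ j, Matched σ (v j) (w j)) (_ : ∀ j, Matched σ (xs j) (ys j)),
        (∀ᶠ i in (hyperfilter ℕ : Filter ℕ),
          φ.all.Realize (fun j => w j i) (fun j => ys j i)) →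
        ∀ᶠ i in (hyperfilter ℕ : Filter ℕ),
          φ.all.Realize (fun j => v j i) (fun j => xs j i) := by
      intro σ hs v w xs ys hvw hxy hall
      by_contra hn
      rw [← Ultrafilter.eventually_not] at hn
      -- Counterexamples chosen coordinatewise form a sequence, to which the forth property gives a
      -- partner; the choice of `∞` elsewhere is irrelevant.
      have hex : ∀ i, ∃ z, ¬ φ.all.Realize (fun j => v j i) (fun j => xs j i) →
          ¬ φ.Realize (fun j => v j i) (Fin.snoc (fun j => xs j i) z) := by
        intro i
        by_cases hi : φ.all.Realize (fun j => v j i) (fun j => xs j i)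
        · exact ⟨GammaInf.top χ c, fun h' => absurd hi h'⟩
        · have hi' := hi
          simp only [BoundedFormula.Realize, not_forall] at hi'
          obtain ⟨z, hz⟩ := hi'
          exact ⟨z, fun _ => hz⟩
      choose z hz using hex
      obtain ⟨σ', hle, hσ', z', hzz'⟩ := exists_forth h hs z
      have key := ih hσ' (v := v) (w := w) (xs := Fin.snoc xs z) (ys := Fin.snoc ys z')
        (fun j => (hvw j).mono hle)
        (fun j => by
          refine Fin.lastCases ?_ (fun j => ?_) j
          · simpa using hzz'
          · simpa using (hxy j).mono hle)
      have hb : ∀ᶠ i in (hyperfilter ℕ : Filter ℕ), φ.Realize (fun j => w j i)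
          (fun j => (Fin.snoc ys z' : Fin (n + 1) → ℕ → GammaInf χ c) j i) := by
        filter_upwards [hall] with i hi
        rw [← snoc]
        exact hi (z' i)
      obtain ⟨i, k1, k2⟩ := ((key.2 hb).and hn).exists
      refine hz i k2 ?_
      rw [snoc]
      exact k1
    intro σ hs v w xs ys hvw hxy
    exact ⟨one hs.swap (fun j => (hvw j).swap) (fun j => (hxy j).swap), one hs hvw hxy⟩

end Matched

end Transfer

/-! ### Cells cut out by finitely many points -/

section Intervals

variable {S : Type u} [LinearOrder S]

/-- Rays unbounded above. -/
def IsUpperRay (L : Set S) : Prop := L = Set.univ ∨ (∃ a, L = Set.Ioi a) ∨ ∃ a, L = Set.Ici a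

/-- Rays unbounded below. -/
def IsLowerRay (U : Set S) : Prop := U = Set.univ ∨ (∃ a, U = Set.Iio a) ∨ ∃ a, U = Set.Iic a

theorem IsUpperRay.inter {L L' : Set S} (h : IsUpperRay L) (h' : IsUpperRay L') :
    IsUpperRay (L ∩ L') := by
  rcases h with rfl | ⟨a, rfl⟩ | ⟨a, rfl⟩
  · rwa [Set.univ_inter]
  · rcases h' with rfl | ⟨b, rfl⟩ | ⟨b, rfl⟩
    · rw [Set.inter_univ]; exact Or.inr (Or.inl ⟨a, rfl⟩)
    · exact Or.inr (Or.inl ⟨a ⊔ b, Set.Ioi_inter_Ioi⟩)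
    · rcases lt_or_ge a b with hab | hab
      · exact Or.inr (Or.inr ⟨b, Set.inter_eq_right.2 fun x hx => hab.trans_le hx⟩)
      · exact Or.inr (Or.inl ⟨a, Set.inter_eq_left.2 fun x hx => hab.trans (le_of_lt hx)⟩)
  · rcases h' with rfl | ⟨b, rfl⟩ | ⟨b, rfl⟩
    · rw [Set.inter_univ]; exact Or.inr (Or.inr ⟨a, rfl⟩)
    · rcases lt_or_ge b a with hab | hab
      · exact Or.inr (Or.inr ⟨a, Set.inter_eq_left.2 fun x hx => hab.trans_le hx⟩)
      · exact Or.inr (Or.inl ⟨b, Set.inter_eq_right.2 fun x hx => hab.trans (le_of_lt hx)⟩)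
    · exact Or.inr (Or.inr ⟨a ⊔ b, Set.Ici_inter_Ici⟩)

theorem IsLowerRay.inter {U U' : Set S} (h : IsLowerRay U) (h' : IsLowerRay U') :
    IsLowerRay (U ∩ U') :=
  IsUpperRay.inter (S := Sᵒᵈ) h h'

theorem IsUpperRay.isInterval_inter {L U : Set S} (hL : IsUpperRay L) (hU : IsLowerRay U) :
    IsInterval (L ∩ U) := by
  rcases hL with rfl | ⟨a, rfl⟩ | ⟨a, rfl⟩ <;> rcases hU with rfl | ⟨b, rfl⟩ | ⟨b, rfl⟩
  · simpa using IsInterval.univ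
  · simpa using IsInterval.Iio b
  · simpa using IsInterval.Iic b
  · simpa using IsInterval.Ioi a
  · exact IsInterval.Ioo a b
  · exact IsInterval.Ioc a b
  · simpa using IsInterval.Ici a
  · exact IsInterval.Ico a b
  · exact IsInterval.Icc a b

/-- Each point of `E` restricts the cell to a ray on one side of it, or to the point itself, and
rays of one direction are closed under intersection. -/
theorem exists_cell_eq_inter (E : Finset S) (x : S) :
    ∃ L U : Set S, IsUpperRay L ∧ IsLowerRay U ∧
      {y | ∀ e ∈ E, (x < e ↔ y < e) ∧ (e < x ↔ e < y)} = L ∩ U := by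
  classical
  induction E using Finset.induction_on with
  | empty => exact ⟨Set.univ, Set.univ, Or.inl rfl, Or.inl rfl, by simp⟩
  | insert e E he ih =>
    obtain ⟨L, U, hL, hU, h⟩ := ih
    obtain ⟨L', U', hL', hU', h'⟩ : ∃ L' U' : Set S, IsUpperRay L' ∧ IsLowerRay U' ∧
        {y | (x < e ↔ y < e) ∧ (e < x ↔ e < y)} = L' ∩ U' := by
      rcases lt_trichotomy x e with hx | rfl | hx
      · refine ⟨Set.univ, Set.Iio e, Or.inl rfl, Or.inr (Or.inl ⟨e, rfl⟩), ?_⟩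
        ext y
        simp only [Set.mem_ofPred_eq, hx, hx.not_gt, true_iff, false_iff, Set.univ_inter, Set.mem_Iio,
          and_iff_left_iff_imp]
        exact fun h => h.not_gt
      · refine ⟨Set.Ici x, Set.Iic x, Or.inr (Or.inr ⟨x, rfl⟩), Or.inr (Or.inr ⟨x, rfl⟩), ?_⟩
        ext y
        simp
      · refine ⟨Set.Ioi e, Set.univ, Or.inr (Or.inl ⟨e, rfl⟩), Or.inl rfl, ?_⟩
        ext y
        simp only [Set.mem_ofPred_eq, hx, hx.not_gt, true_iff, false_iff, Set.inter_univ, Set.mem_Ioi,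
          and_iff_right_iff_imp]
        exact fun h => h.not_gt
    refine ⟨L' ∩ L, U' ∩ U, hL'.inter hL, hU'.inter hU, ?_⟩
    rw [Set.inter_inter_inter_comm, ← h, ← h']
    ext y
    simp only [Finset.forall_mem_insert, Set.mem_ofPred_eq, Set.mem_inter_iff]

/-- A set which is determined by the position relative to finitely many points is a finite union of
intervals. -/
theorem exists_finite_isInterval (E : Finset S) (A : Set S)
    (hA : ∀ x y, (∀ e ∈ E, (x < e ↔ y < e) ∧ (e < x ↔ e < y)) → x ∈ A → y ∈ A) :
    ∃ F : Set (Set S), F.Finite ∧ (∀ I ∈ F, IsInterval I) ∧ A = ⋃₀ F := by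
  classical
  let cell : S → Set S := fun x => {y | ∀ e ∈ E, (x < e ↔ y < e) ∧ (e < x ↔ e < y)}
  refine ⟨cell '' A, ?_, ?_, ?_⟩
  · let g : Finset S × Finset S → Set S :=
      fun p => {y | ∀ e ∈ E, (e ∈ p.1 ↔ y < e) ∧ (e ∈ p.2 ↔ e < y)}
    refine ((E.powerset ×ˢ E.powerset).finite_toSet.image g).subset ?_
    rintro _ ⟨x, -, rfl⟩
    refine ⟨(E.filter (x < ·), E.filter (· < x)), ?_, ?_⟩
    · simp only [Finset.coe_product, Set.mem_prod, Finset.mem_coe, Finset.mem_powerset]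
      exact ⟨Finset.filter_subset _ _, Finset.filter_subset _ _⟩
    ext y
    simp only [g, cell, Set.mem_ofPred_eq, Finset.mem_filter]
    refine forall₂_congr fun e he => ?_
    simp only [he, true_and]
  · rintro _ ⟨x, -, rfl⟩
    obtain ⟨L, U, hL, hU, h⟩ := exists_cell_eq_inter E x
    change IsInterval {y | ∀ e ∈ E, (x < e ↔ y < e) ∧ (e < x ↔ e < y)}
    rw [h]
    exact hL.isInterval_inter hU
  · ext x
    simp only [Set.sUnion_image, Set.mem_iUnion, exists_prop]
    exact ⟨fun hx => ⟨x, hx, fun e _ => ⟨Iff.rfl, Iff.rfl⟩⟩, fun ⟨z, hz, hzx⟩ => hA z x hzx hz⟩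

end Intervals

/-! ### Definable subsets of Δ -/

section Definable

open Filter Language

/-- Makes substructures generated by finitely many parameters countable. -/
instance : Countable (Σ l, LpdgStar.Functions l) := by
  let f : (Σ l, PdgStarFunc l) → ℕ ⊕ ℕ+ := fun p => match p with
    | ⟨_, .zero⟩ => Sum.inl 0
    | ⟨_, .c⟩ => Sum.inl 1
    | ⟨_, .infty⟩ => Sum.inl 2
    | ⟨_, .neg⟩ => Sum.inl 3
    | ⟨_, .chi⟩ => Sum.inl 4
    | ⟨_, .chiInv⟩ => Sum.inl 5
    | ⟨_, .add⟩ => Sum.inl 6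
    | ⟨_, .delta n⟩ => Sum.inr n
  have hf : Function.Injective f := by
    rintro ⟨_, a⟩ ⟨_, b⟩ hab
    cases a <;> cases b <;> simp_all [f]
  exact hf.countable

variable {Γ : Type u} [AddCommGroup Γ] [LinearOrder Γ] [IsOrderedAddMonoid Γ]
  {χ : Γ → Γ} {c : Γ}

/-- The elements of `Γ` in a substructure of `Γ_∞`. -/
noncomputable def substructureGroup (K : LpdgStar.Substructure (GammaInf χ c)) : AddSubgroup Γ where
  carrier := {a | GammaInf.of χ c a ∈ K}
  zero_mem' := K.fun_mem (PdgStarFunc.zero : LpdgStar.Functions 0) ![] (fun i => i.elim0)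
  add_mem' {a b} ha hb := by
    refine K.fun_mem (PdgStarFunc.add : LpdgStar.Functions 2)
      ![GammaInf.of χ c a, GammaInf.of χ c b] (fun i => ?_)
    fin_cases i
    exacts [ha, hb]
  neg_mem' {a} ha := by
    refine K.fun_mem (PdgStarFunc.neg : LpdgStar.Functions 1) ![GammaInf.of χ c a] (fun i => ?_)
    fin_cases i
    exact ha

section Diagonal

variable {K : LpdgStar.Substructure (GammaInf χ c)}

theorem c_mem_substructureGroup : c ∈ substructureGroup K :=
  K.fun_mem (PdgStarFunc.c : LpdgStar.Functions 0) ![] (fun i => i.elim0)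

theorem chi_mem_substructureGroup {a : Γ} (ha : a ∈ substructureGroup K) :
    χ a ∈ substructureGroup K := by
  refine K.fun_mem (PdgStarFunc.chi : LpdgStar.Functions 1) ![GammaInf.of χ c a] (fun i => ?_)
  fin_cases i
  exact ha

theorem divFun_mem_substructureGroup (n : ℕ+) {a : Γ} (ha : a ∈ substructureGroup K) :
    divFun (n : ℕ) a ∈ substructureGroup K := by
  refine K.fun_mem (PdgStarFunc.delta n : LpdgStar.Functions 1) ![GammaInf.of χ c a] (fun i => ?_)
  fin_cases i
  exact ha

theorem pred_mem_substructureGroup (h : IsModelTpdg χ c) {e : Γ} (he : e ∈ chiNeg χ)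
    (ha : χ e ∈ substructureGroup K) : e ∈ substructureGroup K := by
  have := K.fun_mem (PdgStarFunc.chiInv : LpdgStar.Functions 1) ![GammaInf.of χ c (χ e)]
    (fun i => by fin_cases i; exact ha)
  change chiInvFun χ (χ e : Γ) ∈ K at this
  rw [chiInvFun_chi h he] at this
  exact this

variable [Module ℚ (Ultrapow Γ)]

/-- The identity of a substructure of `Γ_∞`, seen in the ultrapower. -/
noncomputable def diagonalSubmodule (h : IsModelTpdg χ c)
    (K : LpdgStar.Substructure (GammaInf χ c)) : Submodule ℚ (Ultrapow Γ × Ultrapow Γ) where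
  carrier := {p | ∃ a ∈ substructureGroup K, p = (Ultrapow.const a, Ultrapow.const a)}
  zero_mem' := ⟨0, zero_mem _, rfl⟩
  add_mem' := by
    rintro _ _ ⟨a, ha, rfl⟩ ⟨b, hb, rfl⟩
    exact ⟨a + b, add_mem ha hb, rfl⟩
  smul_mem' := by
    rintro r _ ⟨a, ha, rfl⟩
    let n : ℕ+ := ⟨r.den, r.den_pos⟩
    refine ⟨r.num • divFun (n : ℕ) a,
      zsmul_mem (divFun_mem_substructureGroup n ha) _, ?_⟩
    have key : r • Ultrapow.const a = Ultrapow.const (r.num • divFun (n : ℕ) a) := by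
      conv_lhs => rw [← nsmul_divFun h n a]
      have e1 : Ultrapow.const ((n : ℕ) • divFun (n : ℕ) a) =
          ((n : ℕ) : ℚ) • Ultrapow.const (divFun (n : ℕ) a) := by
        rw [Nat.cast_smul_eq_nsmul]; rfl
      have e2 : Ultrapow.const (r.num • divFun (n : ℕ) a) =
          (r.num : ℚ) • Ultrapow.const (divFun (n : ℕ) a) := by
        rw [Int.cast_smul_eq_zsmul]; rfl
      rw [e1, e2, smul_smul]
      congr 1
      exact Rat.mul_den_eq_num r
    rw [← key]; rfl

theorem isBackAndForth_diagonal (h : IsModelTpdg χ c) (hK : (K : Set (GammaInf χ c)).Countable) :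
    IsBackAndForth (Ultrapow.chi χ) (Ultrapow.const c) (diagonalSubmodule h K) where
  countable := by
    have h1 : (substructureGroup K : Set Γ).Countable :=
      hK.preimage (f := GammaInf.of χ c) GammaInf.of_injective
    refine (h1.image fun a => (Ultrapow.const a, Ultrapow.const a)).mono ?_
    rintro _ ⟨a, ha, rfl⟩
    exact ⟨a, ha, rfl⟩
  c_mem := ⟨c, c_mem_substructureGroup, rfl⟩
  pos_iff := by
    rintro _ ⟨a, -, rfl⟩
    rfl
  chi_mem := by
    rintro _ ⟨a, ha, rfl⟩
    exact ⟨χ a, chi_mem_substructureGroup ha, rfl⟩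
  pred_mem := by
    rintro d hd d' hd' ⟨a, ha, hp⟩
    have hU := Ultrapow.isModelTpdg_chi h
    obtain ⟨h1, h2⟩ := Prod.mk.inj hp
    obtain ⟨u, rfl⟩ := d.exists_rep
    -- A predecessor of a constant germ is constant: its value at one good coordinate is a
    -- predecessor of `a` in Γ, and predecessors are unique.
    obtain ⟨i, k1, k2⟩ := ((Ultrapow.coe_mem_chiNeg.1 hd).and (Germ.coe_eq.1 h1)).exists
    replace k2 : χ (u i) = a := k2
    have hmem : Ultrapow.const (u i) ∈ chiNeg (Ultrapow.chi χ) :=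
      Ultrapow.coe_mem_chiNeg.2 (Eventually.of_forall fun _ => k1)
    have hχ : Ultrapow.chi χ (Ultrapow.const (u i)) = Ultrapow.const a :=
      congrArg Ultrapow.const k2
    refine ⟨u i, pred_mem_substructureGroup h k1 (by rw [k2]; exact ha), Prod.ext ?_ ?_⟩
    · exact hU.chi_inj hd hmem (h1.trans hχ.symm)
    · exact hU.chi_inj hd' hmem (h2.trans hχ.symm)

end Diagonal

theorem exists_finite_intervals_of_definable (h : IsModelTpdg χ c) (A : Set (GammaInf χ c))
    (hsub : A ⊆ chiNegInf χ c) (hA : (Set.univ : Set (GammaInf χ c)).Definable₁ LpdgStar A) :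
    ∃ F : Set (Set (chiNegInf χ c)), F.Finite ∧ (∀ I ∈ F, IsInterval I) ∧
      A = Subtype.val '' (⋃₀ F) := by
  have hU := Ultrapow.isModelTpdg_chi h
  let _ : Module ℚ (Ultrapow Γ) := ratModuleOfDivisible hU.divisible
  have : PosSMulStrictMono ℚ (Ultrapow Γ) := posSMulStrictMono_rat
  obtain ⟨A₀, -, hA₀⟩ := Set.definable_iff_finitely_definable.1 hA
  obtain ⟨φ, hφ⟩ := Set.definable_iff_exists_formula_sum.1 hA₀
  have hφ' : ∀ x : GammaInf χ c, x ∈ A ↔ φ.Realize (Sum.elim (fun a => a.1) fun _ => x) := fun x => by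
    have := Set.ext_iff.1 hφ (fun _ => x)
    exact this
  let K := Substructure.closure LpdgStar (A₀ : Set (GammaInf χ c))
  have hK : (K : Set (GammaInf χ c)).Countable :=
    Set.countable_coe_iff.1 (A₀.countable_toSet.substructure_closure LpdgStar)
  have hA₀K : ∀ a ∈ A₀, a ∈ K := fun a ha => Substructure.subset_closure ha
  let B : Set (chiNegInf χ c) := {x | x.1 ∈ A}
  suffices ∃ F : Set (Set (chiNegInf χ c)), F.Finite ∧ (∀ I ∈ F, IsInterval I) ∧ B = ⋃₀ F by
    obtain ⟨F, hF, hI, hBF⟩ := this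
    refine ⟨F, hF, hI, ?_⟩
    rw [← hBF]
    ext x
    exact ⟨fun hx => ⟨⟨x, hsub hx⟩, hx, rfl⟩, fun ⟨y, hy, hyx⟩ => hyx ▸ hy⟩
  let D : Set (chiNegInf χ c) := {x | x.1 ∈ K}
  have hD : D.Countable := hK.preimage (f := Subtype.val) Subtype.val_injective
  have hcD : D.Nonempty :=
    ⟨⟨GammaInf.of χ c c, c, h.c_mem, rfl⟩, c_mem_substructureGroup⟩
  obtain ⟨e, he⟩ := hD.exists_eq_range hcD
  classical
  by_contra hno
  -- If position relative to `e 0, …, e (n - 1)` determined membership, `B` would be a finite union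
  -- of intervals.
  have hbad : ∀ n : ℕ, ∃ x y : chiNegInf χ c, (∀ k < n, (x < e k ↔ y < e k) ∧
      (e k < x ↔ e k < y)) ∧ x ∈ B ∧ y ∉ B := by
    intro n
    by_contra hn
    push Not at hn
    refine hno (exists_finite_isInterval ((Finset.range n).image e) B fun x y hxy hx => ?_)
    exact hn x y (fun k hk => hxy _ (Finset.mem_image_of_mem _ (Finset.mem_range.2 hk))) hx
  choose x y hxy hx hy using hbad
  choose u hu hux using fun n => (x n).2
  choose v hv hvy using fun n => (y n).2
  have hxlt : ∀ {n : ℕ} {a : Γ} (ha : a ∈ chiNeg χ),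
      (x n < ⟨GammaInf.of χ c a, a, ha, rfl⟩ ↔ u n < a) ∧
      (⟨GammaInf.of χ c a, a, ha, rfl⟩ < x n ↔ a < u n) := fun {n a} ha => by
    rw [← Subtype.coe_lt_coe, ← Subtype.coe_lt_coe, ← hux n]
    exact ⟨GammaInf.of_lt_of, GammaInf.of_lt_of⟩
  have hylt : ∀ {n : ℕ} {a : Γ} (ha : a ∈ chiNeg χ),
      (y n < ⟨GammaInf.of χ c a, a, ha, rfl⟩ ↔ v n < a) ∧
      (⟨GammaInf.of χ c a, a, ha, rfl⟩ < y n ↔ a < v n) := fun {n a} ha => by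
    rw [← Subtype.coe_lt_coe, ← Subtype.coe_lt_coe, ← hvy n]
    exact ⟨GammaInf.of_lt_of, GammaInf.of_lt_of⟩
  have hd : (u : Ultrapow Γ) ∈ chiNeg (Ultrapow.chi χ) :=
    Ultrapow.coe_mem_chiNeg.2 (Eventually.of_forall hu)
  have hd' : (v : Ultrapow Γ) ∈ chiNeg (Ultrapow.chi χ) :=
    Ultrapow.coe_mem_chiNeg.2 (Eventually.of_forall hv)
  have hσ := isBackAndForth_diagonal h hK
  have hcmp : ∀ a ∈ substructureGroup K, a ∈ chiNeg χ → ∀ᶠ i in (hyperfilter ℕ : Filter ℕ),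
      (u i < a ↔ v i < a) ∧ (a < u i ↔ a < v i) := by
    intro a haK ha
    have hmem : (⟨GammaInf.of χ c a, a, ha, rfl⟩ : chiNegInf χ c) ∈ D := haK
    rw [he] at hmem
    obtain ⟨k, hk⟩ := hmem
    filter_upwards [Nat.hyperfilter_le_atTop (eventually_gt_atTop k)] with i hi
    have := hxy i k hi
    rwa [hk, (hxlt ha).1, (hxlt ha).2, (hylt ha).1, (hylt ha).2] at this
  obtain ⟨σ', hle, hσ', hm⟩ := hσ.exists_extension_of_cut hU hd hd' (by
    rintro _ ⟨⟨a, haK, rfl⟩, haΔ, -⟩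
    have ha : a ∈ chiNeg χ := (Ultrapow.coe_mem_chiNeg.1 haΔ).exists.choose_spec
    have hc := hcmp a haK ha
    rcases lt_trichotomy (Ultrapow.const a) (u : Ultrapow Γ) with hlt | heq | hlt
    · refine Or.inl ⟨hlt, Germ.coe_lt.2 ?_⟩
      filter_upwards [hc, Germ.coe_lt.1 hlt] with i k1 k2 using k1.2.1 k2
    -- If the germ of `u` were a constant from `K`, then at some coordinate `v` would take the same
    -- value, giving one point both inside and outside `B`.
    · exfalso
      obtain ⟨i, k1, k2⟩ := (hc.and (Germ.coe_eq.1 heq)).exists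
      rw [← k2] at k1
      simp only [lt_irrefl, false_iff, not_lt] at k1
      have hvu : v i = u i := (le_antisymm k1.2 k1.1).trans k2
      have : x i = y i := Subtype.ext ((hux i).symm.trans (hvu ▸ hvy i))
      exact hy i (this ▸ hx i)
    · refine Or.inr ⟨hlt, Germ.coe_lt.2 ?_⟩
      filter_upwards [hc, Germ.coe_lt.1 hlt] with i k1 k2 using k1.1.1 k2)
  have hmatch : ∀ j : (A₀ : Set (GammaInf χ c)) ⊕ Fin 1,
      Matched (χ := χ) (c := c) σ'
        ((Sum.elim (fun a _ => a.1) fun _ i => (x i).1 :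
          (A₀ : Set (GammaInf χ c)) ⊕ Fin 1 → ℕ → GammaInf χ c) j)
        ((Sum.elim (fun a _ => a.1) fun _ i => (y i).1 :
          (A₀ : Set (GammaInf χ c)) ⊕ Fin 1 → ℕ → GammaInf χ c) j) := by
    rintro (⟨a, ha⟩ | j)
    · rcases a.eq_top_or with rfl | ⟨b, rfl⟩
      · exact Or.inl ⟨Eventually.of_forall fun _ => rfl, Eventually.of_forall fun _ => rfl⟩
      · exact Matched.const_mem (hle ⟨b, hA₀K _ ha, rfl⟩)
    · exact Or.inr ⟨u, v, Eventually.of_forall fun i => (hux i).symm,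
        Eventually.of_forall fun i => (hvy i).symm, hm⟩
  have key := Matched.realize_iff h φ hσ' (xs := default) (ys := default) hmatch
    (fun j => j.elim0)
  have hval : ∀ (z : ℕ → GammaInf χ c) (i : ℕ),
      BoundedFormula.Realize φ (fun j => (Sum.elim (fun a _ => a.1) fun _ i => z i :
        (A₀ : Set (GammaInf χ c)) ⊕ Fin 1 → ℕ → GammaInf χ c) j i)
        (fun j => (default : Fin 0 → ℕ → GammaInf χ c) j i) ↔ z i ∈ A := by
    intro z i
    rw [hφ', Formula.Realize]
    have e1 : (fun j => (Sum.elim (fun a _ => a.1) fun _ i => z i :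
        (A₀ : Set (GammaInf χ c)) ⊕ Fin 1 → ℕ → GammaInf χ c) j i) =
        Sum.elim (fun a => a.1) fun _ => z i := by
      funext j
      cases j <;> rfl
    have e2 : (fun j => (default : Fin 0 → ℕ → GammaInf χ c) j i) = default :=
      Subsingleton.elim _ _
    rw [e1, e2]
  simp only [hval] at key
  obtain ⟨i, hi⟩ := (key.1 (Eventually.of_forall hx)).exists
  exact hy i hi

end Definable

/-! ### Failure of weak o-minimality -/

section NotWeaklyOMinimal

open Language

variable {Γ : Type u} [AddCommGroup Γ] [LinearOrder Γ] [IsOrderedAddMonoid Γ]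
  {χ : Γ → Γ} {c : Γ}

/-- For negative `x`, the equation χ⁻¹(χ(x)) = x singles out Δ, because χ⁻¹ returns the preimage
lying in Δ. -/
theorem definable_chiNegInf (h : IsModelTpdg χ c) :
    (Set.univ : Set (GammaInf χ c)).Definable₁ LpdgStar (chiNegInf χ c) := by
  let t : LpdgStar.Term (Fin 1) := Term.var 0
  let φ : LpdgStar.Formula (Fin 1) :=
    LpdgStar.ltSymb.formula₂ t (Constants.term (PdgStarFunc.zero : LpdgStar.Functions 0)) ⊓
    Term.equal (Functions.apply₁ (PdgStarFunc.chiInv : LpdgStar.Functions 1)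
      (Functions.apply₁ (PdgStarFunc.chi : LpdgStar.Functions 1) t)) t
  refine (Set.empty_definable_iff.2 ⟨φ, ?_⟩).mono (Set.empty_subset _)
  ext x
  have hreal : φ.Realize x ↔ (x 0 < GammaInf.of χ c 0 ∧
      chiInvFun χ (WithTop.map χ (x 0)) = x 0) := by
    rw [Formula.realize_inf, Formula.realize_rel₂, Formula.realize_equal]
    rfl
  simp only [Set.mem_ofPred_eq]
  rw [hreal]
  constructor
  · rintro ⟨a, ha, hax⟩
    rw [← hax]
    exact ⟨GammaInf.of_lt_of.2 (h.neg_of_mem ha), chiInvFun_chi h ha⟩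
  · rintro ⟨h1, h2⟩
    rcases (x 0).eq_top_or with hx | ⟨a, hx⟩
    · rw [hx] at h1
      exact absurd h1 (GammaInf.not_top_lt _)
    · rw [hx] at h1 h2
      have ha := GammaInf.of_lt_of.1 h1
      rcases (chiInvFun_eq_coe_iff h).1 h2 with h3 | h3 | h3
      · exact absurd h3.2 ha.ne
      · exact ⟨a, h3.1, hx.symm⟩
      · exact absurd (h.neg_of_mem h3.1) (neg_pos.2 ha).not_gt

theorem not_isWeaklyOMinimalStructure (h : IsModelTpdg χ c) :
    ¬ IsWeaklyOMinimalStructure LpdgStar LpdgStar.ltSymb (GammaInf χ c) := by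
  intro hw
  obtain ⟨F, hF, hconv, hAF⟩ := hw _ (definable_chiNegInf h)
  have hmem : ∀ n : ℕ, ∃ C ∈ F, GammaInf.of χ c (χ^[n] c) ∈ C := fun n => by
    have : GammaInf.of χ c (χ^[n] c) ∈ chiNegInf χ c := ⟨_, h.iterate_mem h.c_mem n, rfl⟩
    rwa [hAF] at this
  choose C hCF hC using hmem
  have := hF.to_subtype
  obtain ⟨n, m, hne, hnm⟩ := Finite.exists_ne_map_eq_of_infinite (fun n => (⟨C n, hCF n⟩ : F))
  have hnm' : C n = C m := congrArg Subtype.val hnm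
  wlog hlt : n < m generalizing n m
  · exact this m n hne.symm hnm.symm hnm'.symm (lt_of_le_of_ne (not_lt.1 hlt) hne.symm)
  have hd := h.iterate_mem h.c_mem n
  have hd0 := h.neg_of_mem hd
  -- Two iterates of `c` share a convex piece. Half of the smaller one lies strictly between it and
  -- its successor and has the same χ-value, so injectivity of χ on Δ keeps it out of Δ.
  obtain ⟨b, hb⟩ := h.divisible 2 two_pos (χ^[n] c)
  rw [two_nsmul] at hb
  have hb0 : b < 0 := by
    by_contra hn
    exact absurd hd0 (hb ▸ add_nonneg (not_lt.1 hn) (not_lt.1 hn)).not_gt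
  have hχb : χ b = χ (χ^[n] c) := by rw [← hb, h.precontraction.map_two_nsmul]
  have h1 : χ^[n] c < b := by
    rw [← hb]
    simpa using hb0
  have h2 : b < χ^[n + 1] c := by
    rw [Function.iterate_succ_apply', ← hχb]
    exact h.lt_chi hb0
  have h3 : χ^[n + 1] c ≤ χ^[m] c := (h.iterate_strictMono h.c_mem).monotone hlt
  have hbC : GammaInf.of χ c b ∈ C n :=
    hconv _ (hCF n) _ (hC n) _ (hnm' ▸ hC m) _ (GammaInf.of_lt_of.2 h1)
      (GammaInf.of_lt_of.2 (h2.trans_le h3))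
  have hbΔ : GammaInf.of χ c b ∈ chiNegInf χ c := by
    rw [hAF]
    exact ⟨_, hCF n, hbC⟩
  obtain ⟨a, ha, hab⟩ := hbΔ
  rw [GammaInf.of_injective hab] at ha
  exact h1.ne' (h.chi_inj ha hd hχb)

end NotWeaklyOMinimal

/-! ### A model of T_pdg -/

section LexModel

/-- The lexicographically ordered group of rational sequences. -/
abbrev LexSeq : Type u := Lex (ULift.{u} ℕ → ℚ)

namespace LexSeq

/-- The coefficient of `a` at `i`. -/
def coeff (a : LexSeq.{u}) (i : ULift.{u} ℕ) : ℚ := ofLex a i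

/-- The unit vector at `i`. -/
def unit (i : ULift.{u} ℕ) : LexSeq.{u} := toLex (Pi.single i 1)

/-- The index following `i`. -/
def next (i : ULift.{u} ℕ) : ULift.{u} ℕ := ⟨i.down + 1⟩

/-- The first nonzero coefficient of `a` is positive and has index `i`. -/
def PosLead (a : LexSeq.{u}) (i : ULift.{u} ℕ) : Prop := (∀ j < i, a.coeff j = 0) ∧ 0 < a.coeff i

theorem lt_iff {a b : LexSeq.{u}} :
    a < b ↔ ∃ i, (∀ j < i, a.coeff j = b.coeff j) ∧ a.coeff i < b.coeff i := Iff.rfl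

theorem pos_iff {a : LexSeq.{u}} : 0 < a ↔ ∃ i, PosLead a i := by
  rw [lt_iff]
  exact exists_congr fun i => and_congr (forall₂_congr fun j _ => eq_comm) Iff.rfl

theorem PosLead.le_of_le {a b : LexSeq.{u}} {i j : ULift.{u} ℕ} (ha : PosLead a i)
    (hb : PosLead b j) (hab : a ≤ b) : j ≤ i := by
  by_contra hn
  rw [not_le] at hn
  refine absurd hab (not_le.2 (lt_iff.2 ⟨i, fun k hk => ?_, ?_⟩))
  · rw [hb.1 k (hk.trans hn), ha.1 k hk]
  · rw [hb.1 i hn]; exact ha.2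

theorem PosLead.unique {a : LexSeq.{u}} {i j : ULift.{u} ℕ} (hi : PosLead a i)
    (hj : PosLead a j) : i = j :=
  le_antisymm (hj.le_of_le hi le_rfl) (hi.le_of_le hj le_rfl)

theorem PosLead.nsmul {a : LexSeq.{u}} {i : ULift.{u} ℕ} (hi : PosLead a i) {n : ℕ}
    (hn : 0 < n) : PosLead (n • a) i := by
  have key : ∀ j, (n • a).coeff j = n • a.coeff j := fun j => rfl
  refine ⟨fun j hj => by rw [key, hi.1 j hj, smul_zero], ?_⟩
  rw [key]
  exact nsmul_pos hi.2 hn.ne'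

theorem coeff_unit_self (i : ULift.{u} ℕ) : (unit i).coeff i = 1 := Pi.single_eq_same i 1

theorem coeff_unit_of_ne {i j : ULift.{u} ℕ} (h : j ≠ i) : (unit i).coeff j = 0 :=
  Pi.single_eq_of_ne h 1

theorem posLead_unit (i : ULift.{u} ℕ) : PosLead (unit i) i :=
  ⟨fun _ hj => coeff_unit_of_ne hj.ne, by rw [coeff_unit_self]; exact one_pos⟩

theorem unit_pos (i : ULift.{u} ℕ) : 0 < unit i := pos_iff.2 ⟨i, posLead_unit i⟩

theorem unit_strictAnti : StrictAnti unit.{u} := fun i j hij =>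
  lt_iff.2 ⟨i, fun k hk => by
    rw [coeff_unit_of_ne hk.ne, coeff_unit_of_ne (hk.trans hij).ne], by
    rw [coeff_unit_of_ne hij.ne, coeff_unit_self]; exact one_pos⟩

theorem next_strictMono : StrictMono next.{u} := fun i j hij =>
  Nat.succ_lt_succ (show i.down < j.down from hij)

theorem lt_next (i : ULift.{u} ℕ) : i < next i := Nat.lt_succ_self i.down

theorem next_le {i j : ULift.{u} ℕ} (h : i < j) : next i ≤ j :=
  Nat.succ_le_of_lt (show i.down < j.down from h)

open Classical in
/-- The precontraction map sending a positive element with leading index `i` to the unit vector at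
the next index. -/
noncomputable def chi (a : LexSeq.{u}) : LexSeq.{u} :=
  if h : ∃ i, PosLead a i then unit (next h.choose)
  else if h : ∃ i, PosLead (-a) i then -unit (next h.choose) else 0

theorem chi_of_posLead {a : LexSeq.{u}} {i : ULift.{u} ℕ} (h : PosLead a i) :
    chi a = unit (next i) := by
  have hex : ∃ i, PosLead a i := ⟨i, h⟩
  rw [chi, dif_pos hex, hex.choose_spec.unique h]

theorem chi_zero : chi (0 : LexSeq.{u}) = 0 := by
  have h : ¬ ∃ i, PosLead (0 : LexSeq.{u}) i := fun h => lt_irrefl _ (pos_iff.2 h)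
  rw [chi, dif_neg h, dif_neg (by rwa [neg_zero])]

theorem chi_neg (a : LexSeq.{u}) : chi (-a) = -chi a := by
  have key : ∀ a : LexSeq.{u}, 0 < a → chi (-a) = -chi a := by
    intro a ha
    obtain ⟨i, hi⟩ := pos_iff.1 ha
    have h1 : ¬ ∃ i, PosLead (-a) i := fun h => (neg_lt_zero.2 ha).not_gt (pos_iff.2 h)
    have h2 : ∃ i, PosLead (- -a) i := ⟨i, by rwa [neg_neg]⟩
    have h3 := h2.choose_spec
    have h4 : h2.choose = i := PosLead.unique (a := a) (by simpa only [neg_neg] using h3) hi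
    rw [chi_of_posLead hi, chi, dif_neg h1, dif_pos h2, h4]
  rcases lt_trichotomy a 0 with ha | rfl | ha
  · have := key (-a) (neg_pos.2 ha)
    rw [neg_neg] at this
    rw [this, neg_neg]
  · rw [neg_zero, chi_zero, neg_zero]
  · exact key a ha

theorem chi_pos {a : LexSeq.{u}} (ha : 0 < a) : 0 < chi a := by
  obtain ⟨i, hi⟩ := pos_iff.1 ha
  rw [chi_of_posLead hi]
  exact unit_pos _

theorem chi_neg_unit (i : ULift.{u} ℕ) : chi (-unit i) = -unit (next i) := by
  rw [chi_neg, chi_of_posLead (posLead_unit i)]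

theorem isPrecontraction_chi : IsPrecontraction chi.{u} := by
  have hmono : ∀ a b : LexSeq.{u}, 0 < a → a ≤ b → chi a ≤ chi b := by
    intro a b ha hab
    obtain ⟨i, hi⟩ := pos_iff.1 ha
    obtain ⟨j, hj⟩ := pos_iff.1 (ha.trans_le hab)
    rw [chi_of_posLead hi, chi_of_posLead hj]
    exact unit_strictAnti.antitone (next_strictMono.monotone (hi.le_of_le hj hab))
  -- From `a ≤ n • b`, with `n • b` having the leading index of `b`.
  have hle : ∀ a b : LexSeq.{u}, 0 < a → 0 < b → ArchimedeanClass.mk a = ArchimedeanClass.mk b →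
      chi a ≤ chi b := by
    intro a b ha hb hab
    obtain ⟨-, n, hn⟩ := ArchimedeanClass.mk_eq_mk.1 hab
    rw [abs_of_pos ha, abs_of_pos hb] at hn
    have hn0 : 0 < n := by
      rcases Nat.eq_zero_or_pos n with rfl | h
      · rw [zero_smul] at hn
        exact absurd ha hn.not_gt
      · exact h
    obtain ⟨i, hi⟩ := pos_iff.1 hb
    rw [chi_of_posLead hi, ← chi_of_posLead (hi.nsmul hn0)]
    exact hmono _ _ ha hn
  refine ⟨fun a => ⟨fun h => ?_, fun h => h ▸ chi_zero⟩, fun a b hab => ?_, chi_neg,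
    fun a b hab hs => ?_⟩
  · rcases lt_trichotomy a 0 with ha | ha | ha
    · have := chi_pos (neg_pos.2 ha)
      rw [chi_neg, h, neg_zero] at this
      exact absurd this (lt_irrefl _)
    · exact ha
    · exact absurd h (chi_pos ha).ne'
  · rcases lt_or_ge 0 a with ha | ha
    · exact hmono a b ha hab
    rcases lt_or_ge b 0 with hb | hb
    · have := hmono (-b) (-a) (neg_pos.2 hb) (neg_le_neg hab)
      rw [chi_neg, chi_neg] at this
      exact neg_le_neg_iff.1 this
    · have h1 : chi a ≤ 0 := by
        rcases ha.eq_or_lt with rfl | ha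
        · rw [chi_zero]
        · have := chi_pos (neg_pos.2 ha)
          rw [chi_neg] at this
          exact (neg_pos.1 this).le
      have h2 : 0 ≤ chi b := by
        rcases hb.eq_or_lt with rfl | hb
        · rw [chi_zero]
        · exact (chi_pos hb).le
      exact h1.trans h2
  · rcases lt_trichotomy a 0 with ha | ha | ha
    · rw [sign_neg ha, eq_comm, sign_eq_neg_one_iff] at hs
      rw [← ArchimedeanClass.mk_neg a, ← ArchimedeanClass.mk_neg b] at hab
      have k := le_antisymm (hle _ _ (neg_pos.2 ha) (neg_pos.2 hs) hab)
        (hle _ _ (neg_pos.2 hs) (neg_pos.2 ha) hab.symm)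
      rw [chi_neg, chi_neg] at k
      exact neg_inj.1 k
    · rw [ha, sign_zero, eq_comm, sign_eq_zero_iff] at hs
      rw [ha, hs]
    · rw [sign_pos ha, eq_comm, sign_eq_one_iff] at hs
      exact le_antisymm (hle _ _ ha hs hab) (hle _ _ hs ha hab.symm)

theorem mem_chiNeg {x : LexSeq.{u}} : x ∈ chiNeg chi.{u} ↔ ∃ i, x = -unit (next i) := by
  constructor
  · rintro ⟨a, ha, rfl⟩
    obtain ⟨i, hi⟩ := pos_iff.1 (neg_pos.2 ha)
    exact ⟨i, by rw [← chi_of_posLead hi, chi_neg, neg_neg]⟩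
  · rintro ⟨i, rfl⟩
    exact ⟨-unit i, neg_lt_zero.2 (unit_pos i), chi_neg_unit i⟩

theorem neg_unit_lt_iff {i j : ULift.{u} ℕ} : -unit i < -unit j ↔ i < j :=
  neg_lt_neg_iff.trans unit_strictAnti.lt_iff_gt

/-- Here Δ consists of the negated unit vectors of positive index, a copy of ℕ whose least element
has index 1, and χ shifts the index. The shift also makes χ centripetal, as larger indices are
infinitely smaller. -/
theorem isModelTpdg_chi : IsModelTpdg chi.{u} (-unit (next ⟨0⟩)) where
  nontrivial := ⟨⟨unit ⟨0⟩, 0, (unit_pos _).ne'⟩⟩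
  precontraction := isPrecontraction_chi
  centripetal a ha := by
    have key : ∀ a : LexSeq.{u}, 0 < a → |chi a| < |a| := by
      intro a ha
      obtain ⟨i, hi⟩ := pos_iff.1 ha
      rw [abs_of_pos ha, abs_of_pos (chi_pos ha), chi_of_posLead hi]
      refine lt_iff.2 ⟨i, fun j hj => ?_, ?_⟩
      · rw [hi.1 j hj, coeff_unit_of_ne (hj.trans (lt_next i)).ne]
      · rw [coeff_unit_of_ne (lt_next i).ne]
        exact hi.2
    rcases lt_or_gt_of_ne ha with ha | ha
    · have := key (-a) (neg_pos.2 ha)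
      rwa [chi_neg, abs_neg, abs_neg] at this
    · exact key a ha
  isLeast := by
    refine ⟨mem_chiNeg.2 ⟨_, rfl⟩, fun x hx => ?_⟩
    obtain ⟨i, rfl⟩ := mem_chiNeg.1 hx
    exact neg_le_neg (unit_strictAnti.antitone (next_strictMono.monotone (Nat.zero_le i.down)))
  bijOn := by
    refine ⟨fun x hx => ?_, fun x hx y hy hxy => ?_, fun x hx => ?_⟩
    · obtain ⟨i, rfl⟩ := mem_chiNeg.1 hx
      rw [chi_neg_unit]
      refine ⟨mem_chiNeg.2 ⟨_, rfl⟩, neg_unit_lt_iff.2 (next_strictMono ?_)⟩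
      exact Nat.succ_pos i.down
    · obtain ⟨i, rfl⟩ := mem_chiNeg.1 hx
      obtain ⟨j, rfl⟩ := mem_chiNeg.1 hy
      rw [chi_neg_unit, chi_neg_unit, neg_inj] at hxy
      rw [next_strictMono.injective (unit_strictAnti.injective hxy)]
    · obtain ⟨⟨i⟩, rfl⟩ := mem_chiNeg.1 hx.1
      have hi : 0 < i := next_strictMono.lt_iff_lt.1 (neg_unit_lt_iff.1 hx.2)
      obtain ⟨k, rfl⟩ := Nat.exists_eq_succ_of_ne_zero hi.ne'
      exact ⟨-unit (next ⟨k⟩), mem_chiNeg.2 ⟨_, rfl⟩, chi_neg_unit _⟩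
  succ x hx y hy hxy := by
    obtain ⟨i, rfl⟩ := mem_chiNeg.1 hx
    obtain ⟨j, rfl⟩ := mem_chiNeg.1 hy
    rw [chi_neg_unit]
    exact ⟨neg_unit_lt_iff.2 (lt_next _),
      neg_le_neg (unit_strictAnti.antitone (next_le (neg_unit_lt_iff.1 hxy)))⟩
  divisible n hn a := by
    refine ⟨toLex fun i => a.coeff i / n, ?_⟩
    funext i
    change n • (a.coeff i / n) = a.coeff i
    rw [nsmul_eq_mul, mul_div_cancel₀]
    exact_mod_cast hn.ne'

end LexSeq

end LexModel

theorem mainTheorem3 :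
    (∀ (Γ : Type u) [AddCommGroup Γ] [LinearOrder Γ] [IsOrderedAddMonoid Γ]
      (χ : Γ → Γ) (c : Γ), IsModelTpdg χ c →
        (∀ A : Set (GammaInf χ c), A ⊆ chiNegInf χ c →
          (Set.univ : Set (GammaInf χ c)).Definable₁ LpdgStar A →
          ∃ F : Set (Set (chiNegInf χ c)), F.Finite ∧
            (∀ I ∈ F, IsInterval I ∨ ∃ s, I = {s}) ∧
            A = Subtype.val '' (⋃₀ F)) ∧
        ¬ IsWeaklyOMinimalStructure LpdgStar LpdgStar.ltSymb (GammaInf χ c)) ∧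
    ¬ IsWeaklyOMinimalTheory.{u} TpdgStar.{u} LpdgStar.ltSymb := by
  refine ⟨fun Γ _ _ _ χ c h => ⟨fun A hsub hA => ?_, not_isWeaklyOMinimalStructure h⟩, fun hw => ?_⟩
  · obtain ⟨F, hF, hI, hAF⟩ := exists_finite_intervals_of_definable h A hsub hA
    exact ⟨F, hF, fun I hIF => Or.inl (hI I hIF), hAF⟩
  -- Without an actual model of T_pdg, the failure in each expansion would say nothing about the
  -- theory.
  · have h := LexSeq.isModelTpdg_chi.{u}
    let M := GammaInf LexSeq.chi.{u} (-LexSeq.unit (LexSeq.next ⟨0⟩))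
    have : Nonempty M := ⟨GammaInf.top _ _⟩
    have hM : M ⊨ TpdgStar.{u} :=
      (Language.Theory.model_iff _).2 fun φ hφ => hφ LexSeq.{u} _ _ h
    exact not_isWeaklyOMinimalStructure h (hw M hM)
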